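/- Let $\bar A\in\{0,\star\}^{n\times n}$ and $\bar B\in\{0,\star\}^{n\times m}$ be structured matrices, and let $p_u(1),\dots,p_u(m)\ge 0$ be input costs. A real matrix is a numerical realization of a structured matrix if it vanishes wherever the structured matrix has a $0$. A structured pair is structurally controllable if it has a numerical realization $(A,B)$ for which $\dot x=Ax+Bu$ is controllable (every state can be steered to every state in finite time). Assume that $(\bar A,\bar B)$ is structurally controllable. For $W\subseteq\{1,\dots,m\}$ let $\bar B_W$ consist of the columns of $\bar B$ indexed by $W$, and put $$\mathcal K=\{W:(\bar A,\bar B_W)\text{ is structurally controllable}\},\qquad p(W)=\sum_{j\in W}p_u(j),\qquad p^\star=\min_{W\in\mathcal K}p(W).$$ Let $\mathcal D(\bar A)$ be the digraph on $x_1,\dots,x_n$ with an edge $(x_j,x_i)$ whenever $\bar A_{ij}=\star$, and let $\mathcal N_1,\dots,\mathcal N_q$ be those strongly connected components of $\mathcal D(\bar A)$ that no edge enters from another component. The flow network $\mathcal F(\bar A,\bar B,c)$ has the vertices $s$ (source), $t$ (sink), $\mathcal N_i$ ($1\le i\le q$), $x'_k,x_k$ ($1\le k\le n$), $u_j,u'_j$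 ($1\le j\le m$), and the edges - $(s,\mathcal N_i)$, $(s,x'_k)$, $(u_j,u'_j)$, $(u'_j,t)$, $(x_r,t)$ for all $i,j,k,r$; - $(\mathcal N_i,u'_j)$ whenever $\bar B_{rj}=\star$ for some $x_r\in\mathcal N_i$; - $(x'_k,x_r)$ whenever $\bar A_{kr}=\star$, and $(x'_k,u_j)$ whenever $\bar B_{kj}=\star$. The edge $(u'_j,t)$ has capacity $n+1$ and cost $c(u'_j,t)=p_u(j)$; every other edge has capacity $1$ and cost $0$. A feasible flow is a non-negative real function $f$ on the edges that respects the capacities and is conserved at every vertex other than $s$ and $t$; its value $\varphi_f$ is the total flow on the edges leaving $s$. A feasible solution of the minimum cost fixed flow problem $\mathrm{MCFF}(q+n)$ is a feasible flow $f$ with $\varphi_f\ge q+n$. Put $$c_f=\sum_{e:\,f(e)>0}c(e),\qquad \mathcal I_f=\{j:f(u'_j,t)>0\},\qquad c^\star=\min\{c_g: g\text{ a feasible solution of }\mathrm{MCFF}(q+n)\}.$$ **Theorem.** Let $f$ be a feasible solution of $\mathrm{MCFF}(q+n)$ on $\mathcal F(\bar A,\bar B,c)$, and let $\varepsilon\ge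 1$ be such that $c_f\le\varepsilon\,c^\star$. Then $\mathcal I_f\in\mathcal K$ and $p(\mathcal I_f)\le\varepsilon\,p^\star$. That is, every $\varepsilon$-approximate solution $f$ of $\mathrm{MCFF}(q+n)$ yields an $\varepsilon$-approximate solution $\mathcal I_f$ of the minimum cost constrained input selection problem. -/

import Mathlib

open scoped Matrix

noncomputable section

namespace StructSys

/-! ## Flow networks and the minimum cost fixed flow problem -/

/-- A flow network on a vertex set `V`: a set of directed edges, a source, a sink, edge
capacities and edge costs. -/
structure FlowNetwork (V : Type) where
  IsEdge : V → V → Prop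
  source : V
  sink : V
  cap : V × V → ℝ
  cost : V × V → ℝ

namespace FlowNetwork

variable {V : Type}

/-- The edge set of the network. -/
abbrev Edge (F : FlowNetwork V) : Type := {e : V × V // F.IsEdge e.1 e.2}

instance [Finite V] (F : FlowNetwork V) : Fintype F.Edge := Fintype.ofFinite _

variable [Finite V] (F : FlowNetwork V)

open Classical in
/-- A flow vector is feasible if it is non-negative, respects the capacities, and is conserved at
every vertex other than the source and the sink. -/
def IsFeasibleFlow (f : F.Edge → ℝ) : Prop :=
  (∀ e, 0 ≤ f e) ∧ (∀ e, f e ≤ F.cap e.1) ∧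
    ∀ v, v ≠ F.source → v ≠ F.sink →
      ∑ e : F.Edge with e.1.2 = v, f e = ∑ e : F.Edge with e.1.1 = v, f e

open Classical in
/-- The flow value `φ_f`: the total flow on the edges that leave the source. -/
def flowValue (f : F.Edge → ℝ) : ℝ :=
  ∑ e : F.Edge with e.1.1 = F.source, f e

open Classical in
/-- The cost `c_f`: the sum of the costs of all edges that carry positive flow. -/
def flowCost (f : F.Edge → ℝ) : ℝ :=
  ∑ e : F.Edge with 0 < f e, F.cost e.1

/-- `f` is a feasible solution of the minimum cost fixed flow problem `MCFF(φmin)`. -/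
def IsMCFFFeasible (φmin : ℝ) (f : F.Edge → ℝ) : Prop :=
  F.IsFeasibleFlow f ∧ φmin ≤ F.flowValue f

/-- The optimal cost of `MCFF(φmin)`; it is attained, see `isLeast_mcffOptimalCost`. -/
def mcffOptimalCost (φmin : ℝ) : ℝ :=
  sInf (F.flowCost '' {f | F.IsMCFFFeasible φmin f})

theorem isLeast_mcffOptimalCost {φmin : ℝ} {f : F.Edge → ℝ} (hf : F.IsMCFFFeasible φmin f) :
    IsLeast (F.flowCost '' {f | F.IsMCFFFeasible φmin f}) (F.mcffOptimalCost φmin) := by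
  classical
  have hfin : (F.flowCost '' {f | F.IsMCFFFeasible φmin f}).Finite := by
    refine (Set.finite_range (fun S : Finset F.Edge => ∑ e ∈ S, F.cost e.1)).subset ?_
    rintro _ ⟨g, _, rfl⟩
    exact ⟨_, rfl⟩
  exact ⟨Set.Nonempty.csInf_mem ⟨_, f, hf, rfl⟩ hfin, fun _ hx => csInf_le hfin.bddBelow hx⟩

end FlowNetwork

/-! ## Controllability and structural controllability -/

/-- The system `ẋ = A x + B u` is controllable: every initial state can be driven to every final
state in finite time by a continuous input. -/
def Controllable {n : ℕ} {ι : Type} [Fintype ι]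
    (A : Matrix (Fin n) (Fin n) ℝ) (B : Matrix (Fin n) ι ℝ) : Prop :=
  ∀ x₀ x₁ : Fin n → ℝ, ∃ T : ℝ, 0 < T ∧ ∃ (u : ℝ → ι → ℝ) (x : ℝ → Fin n → ℝ),
    ContinuousOn u (Set.Icc 0 T) ∧ x 0 = x₀ ∧ x T = x₁ ∧
      ∀ t ∈ Set.Icc 0 T, HasDerivWithinAt x (A *ᵥ x t + B *ᵥ u t) (Set.Icc 0 T) t

/-- A matrix with entries `0` (`false`) or `⋆` (`true`). -/
abbrev StructMatrix (n : ℕ) (ι : Type) : Type := Matrix (Fin n) ι Bool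

/-- `M` is a numerical realization of `Mbar`: it vanishes wherever `Mbar` does. -/
def IsRealization {n : ℕ} {ι : Type} (Mbar : StructMatrix n ι) (M : Matrix (Fin n) ι ℝ) : Prop :=
  ∀ i j, Mbar i j = false → M i j = 0

/-- Some numerical realization of `(Abar, Bbar)` is controllable. -/
def StructurallyControllable {n : ℕ} {ι : Type} [Fintype ι]
    (Abar : StructMatrix n (Fin n)) (Bbar : StructMatrix n ι) : Prop :=
  ∃ (A : Matrix (Fin n) (Fin n) ℝ) (B : Matrix (Fin n) ι ℝ),
    IsRealization Abar A ∧ IsRealization Bbar B ∧ Controllable A B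

/-! ## Minimum cost constrained input selection -/

section InputSelection

variable {n m : ℕ}

/-- The restriction of `Bbar` to the columns in `W`. -/
def restrictCols (Bbar : StructMatrix n (Fin m)) (W : Finset (Fin m)) : StructMatrix n W :=
  fun i j => Bbar i j

/-- The family `K` of the input sets that keep the system structurally controllable. -/
def admissibleInputs (Abar : StructMatrix n (Fin n)) (Bbar : StructMatrix n (Fin m)) :
    Set (Finset (Fin m)) :=
  {W | StructurallyControllable Abar (restrictCols Bbar W)}

/-- The cost `p(I)` of an input set. -/
def inputCost (p : Fin m → ℝ) (I : Finset (Fin m)) : ℝ := ∑ j ∈ I, p j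

/-- The optimal cost `p⋆` of minCCIS; it is attained, see `isLeast_minInputCost`. -/
def minInputCost (Abar : StructMatrix n (Fin n)) (Bbar : StructMatrix n (Fin m))
    (p : Fin m → ℝ) : ℝ :=
  sInf (inputCost p '' admissibleInputs Abar Bbar)

theorem univ_mem_admissibleInputs {Abar : StructMatrix n (Fin n)} {Bbar : StructMatrix n (Fin m)}
    (h : StructurallyControllable Abar Bbar) : Finset.univ ∈ admissibleInputs Abar Bbar := by
  obtain ⟨A, B, hA, hB, hc⟩ := h
  refine ⟨A, fun i j => B i j, hA, fun i j hij => hB i j hij, fun x₀ x₁ => ?_⟩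
  obtain ⟨T, hT, u, x, hu, h0, h1, hx⟩ := hc x₀ x₁
  refine ⟨T, hT, fun t j => u t j, x, ?_, h0, h1, fun t ht => ?_⟩
  · rw [continuousOn_pi] at hu ⊢
    exact fun j => hu j
  · convert hx t ht using 2
    ext i
    simp only [Matrix.mulVec, dotProduct]
    exact Finset.sum_coe_sort Finset.univ (fun j => B i j * u t j)

theorem isLeast_minInputCost {Abar : StructMatrix n (Fin n)} {Bbar : StructMatrix n (Fin m)}
    (p : Fin m → ℝ) (h : StructurallyControllable Abar Bbar) :
    IsLeast (inputCost p '' admissibleInputs Abar Bbar) (minInputCost Abar Bbar p) := by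
  have hfin : (inputCost p '' admissibleInputs Abar Bbar).Finite := Set.toFinite _
  exact ⟨Set.Nonempty.csInf_mem ⟨_, _, univ_mem_admissibleInputs h, rfl⟩ hfin,
    fun _ hx => csInf_le hfin.bddBelow hx⟩

end InputSelection

/-! ## Non-top linked strongly connected components of the state digraph -/

section Components

variable {n : ℕ} (Abar : StructMatrix n (Fin n))

/-- The state digraph has the edge `(x_j, x_i)` whenever `Abar i j` is `⋆`. -/
def StateEdge (j i : Fin n) : Prop := Abar i j = true

/-- There is a (possibly trivial) directed path in the state digraph. -/
def Reaches : Fin n → Fin n → Prop := Relation.ReflTransGen (StateEdge Abar)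

/-- `C` is (the vertex set of) a strongly connected component of the state digraph, that is, a
class of mutually reachable states. -/
def IsSCC (C : Set (Fin n)) : Prop :=
  ∃ v, C = {w | Reaches Abar v w ∧ Reaches Abar w v}

/-- A strongly connected component is non-top linked if no edge enters it from outside. -/
def IsNonTopLinked (C : Set (Fin n)) : Prop :=
  IsSCC Abar C ∧ ∀ j i, StateEdge Abar j i → i ∈ C → j ∈ C

/-- The non-top linked strongly connected components `N_1, …, N_q`. -/
abbrev NonTopSCC : Type := {C : Set (Fin n) // IsNonTopLinked Abar C}

/-- The number `q` of the non-top linked strongly connected components. -/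
def numNonTopSCC : ℕ := Nat.card (NonTopSCC Abar)

end Components

/-! ## The flow network of a structured system -/

/-- The vertices `s`, `t`, `N_i`, `x'_k`, `x_r`, `u_j`, `u'_j`. -/
inductive Vertex (N : Type) (n m : ℕ) : Type
  | s : Vertex N n m
  | t : Vertex N n m
  | scc (C : N) : Vertex N n m
  | x' (k : Fin n) : Vertex N n m
  | x (r : Fin n) : Vertex N n m
  | u (j : Fin m) : Vertex N n m
  | u' (j : Fin m) : Vertex N n m

instance {N : Type} [Finite N] {n m : ℕ} : Finite (Vertex N n m) := by
  let g : (Unit ⊕ Unit) ⊕ (N ⊕ (Fin n ⊕ Fin n)) ⊕ (Fin m ⊕ Fin m) → Vertex N n m :=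
    Sum.elim (Sum.elim (fun _ => .s) (fun _ => .t))
      (Sum.elim (Sum.elim .scc (Sum.elim .x' .x)) (Sum.elim .u .u'))
  refine Finite.of_surjective g fun v => ?_
  cases v with
  | s => exact ⟨.inl (.inl ()), rfl⟩
  | t => exact ⟨.inl (.inr ()), rfl⟩
  | scc C => exact ⟨.inr (.inl (.inl C)), rfl⟩
  | x' k => exact ⟨.inr (.inl (.inr (.inl k))), rfl⟩
  | x r => exact ⟨.inr (.inl (.inr (.inr r))), rfl⟩
  | u j => exact ⟨.inr (.inr (.inl j)), rfl⟩
  | u' j => exact ⟨.inr (.inr (.inr j)), rfl⟩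

section Network

variable {n m : ℕ} (Abar : StructMatrix n (Fin n)) (Bbar : StructMatrix n (Fin m))

/-- The edges of the flow network of `(Abar, Bbar)`. -/
inductive SystemEdge : Vertex (NonTopSCC Abar) n m → Vertex (NonTopSCC Abar) n m → Prop
  | s_scc (C : NonTopSCC Abar) : SystemEdge .s (.scc C)
  | s_x' (k : Fin n) : SystemEdge .s (.x' k)
  | scc_u' (C : NonTopSCC Abar) (r : Fin n) (j : Fin m) (hr : r ∈ C.1)
      (hB : Bbar r j = true) : SystemEdge (.scc C) (.u' j)
  | x'_x (k r : Fin n) (hA : Abar k r = true) : SystemEdge (.x' k) (.x r)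
  | x'_u (k : Fin n) (j : Fin m) (hB : Bbar k j = true) : SystemEdge (.x' k) (.u j)
  | u_u' (j : Fin m) : SystemEdge (.u j) (.u' j)
  | u'_t (j : Fin m) : SystemEdge (.u' j) .t
  | x_t (r : Fin n) : SystemEdge (.x r) .t

/-- The capacities: `n + 1` on the edges `(u'_j, t)`, and `1` on all others. -/
def systemCap {N : Type} {n m : ℕ} : Vertex N n m × Vertex N n m → ℝ
  | (.u' _, .t) => n + 1
  | _ => 1

/-- The costs: `p j` on the edge `(u'_j, t)`, and `0` on all others. -/
def systemCost {N : Type} {n m : ℕ} (p : Fin m → ℝ) : Vertex N n m × Vertex N n m → ℝ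
  | (.u' j, .t) => p j
  | _ => 0

/-- The flow network `F(Abar, Bbar, c)` of a structured system with input costs `p`. -/
def systemNetwork (p : Fin m → ℝ) : FlowNetwork (Vertex (NonTopSCC Abar) n m) where
  IsEdge := SystemEdge Abar Bbar
  source := .s
  sink := .t
  cap := systemCap
  cost := systemCost p

open Classical in
/-- The input set `I_f = {j : f(u'_j, t) > 0}` selected by a flow vector `f`. -/
def selectedInputs (p : Fin m → ℝ) (f : (systemNetwork Abar Bbar p).Edge → ℝ) :
    Finset (Fin m) :=
  {j | 0 < f ⟨(.u' j, .t), SystemEdge.u'_t j⟩}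

end Network

end StructSys

end

/-!
The edges that leave the source have total capacity `q + n`, so a feasible solution of
`MCFF(q + n)` saturates all of them. The unit that reaches a component `N_i` must continue to some
`u'_j` with `j ∈ I_f`, so every non-top linked component receives a selected input. The units that
reach the vertices `x'_k` form a fractional matching of the states into the states and the selected
inputs, and by Hall's theorem its support contains an integral matching
(`exists_injective_of_fractional_matching`). Conversely a component assignment and a matching for an
input set `W` define a feasible flow whose selected inputs lie in `W`
(`exists_isMCFFFeasible_of_mem_admissibleInputs`); the capacity `n + 1` suffices because `q ≤ n`.
As the cost of a flow is the cost of its selected inputs (`flowCost_eq_inputCost`), everything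
rests on Lin's theorem (`structurallyControllable_iff`): a structured system is structurally
controllable exactly when each non-top linked component receives an input and the states can be
matched injectively to in-neighbours.

Lin's theorem is proved through the Hautus test: `(A, B)` is controllable if and only if no complex
left eigenvector of `A` is annihilated by `B`. Such an eigenvector `v` turns `v ⬝ᵥ x` into a
quantity that no input can influence (`Controllable.eq_zero_of_left_eigenvector`). Without one,
the pair satisfies the Kalman condition, because the row vectors annihilated by all `A ^ k * B` form
an `A`-invariant subspace, and a Gramian argument gives the steering input
(`controllable_of_forall_left_eigenvector`). The two conditions of Lin's theorem are necessary
because a failure of either one yields such an eigenvector.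

For sufficiency a realization is built on a growing set `S` of states (`IsPartialRealization`). If
the matched in-neighbour of a state outside `S` is an input or lies in `S`, that state is appended.
Otherwise the matching permutes the complement of `S` in cycles. If no edge led from `S` or an input
to a state outside `S`, the complement would contain a non-top linked component without inputs
(`exists_isNonTopLinked_subset`). So there is such an edge, and the cycle of its target is appended
together with the edge. All edges of the cycle get the same weight `γ`, so that its eigenvalues have
modulus `γ`, and for large `γ` the resolvent of the part already built shows that the cycle is not
hidden from the inputs (`exists_bound_of_observable`).
-/

namespace StructSys

/-! ### The Hautus test for controllability -/

section Hautus

variable {n : ℕ} {ι : Type} [Fintype ι]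

/-- The necessity part of the Hautus test. If `v A = μ v` and `v B = 0`, then
`e^{-μ t} v ⬝ᵥ x(t)` is constant along every trajectory, so that a trajectory starting at `0` stays
in the kernel of `v`. -/
theorem Controllable.eq_zero_of_left_eigenvector
    {A : Matrix (Fin n) (Fin n) ℝ} {B : Matrix (Fin n) ι ℝ} (h : Controllable A B)
    {μ : ℂ} {v : Fin n → ℂ} (hA : v ᵥ* A.map Complex.ofRealHom = μ • v)
    (hB : v ᵥ* B.map Complex.ofRealHom = 0) : v = 0 := by
  by_contra hv
  obtain ⟨r, hr⟩ := Function.ne_iff.1 hv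
  obtain ⟨T, hT, u, x, -, h0, h1, hx⟩ := h 0 (Pi.single r 1)
  have key : ∀ a : Fin n → ℝ, ∀ b : ι → ℝ,
      ∑ k, v k * (((A *ᵥ a + B *ᵥ b) k : ℝ) : ℂ) = μ * ∑ k, v k * (a k : ℂ) := by
    intro a b
    have e1 : ∑ k, v k * (((A *ᵥ a + B *ᵥ b) k : ℝ) : ℂ) =
        v ⬝ᵥ (A.map Complex.ofRealHom *ᵥ (Complex.ofRealHom ∘ a)) +
        v ⬝ᵥ (B.map Complex.ofRealHom *ᵥ (Complex.ofRealHom ∘ b)) := by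
      rw [← dotProduct_add]
      refine Finset.sum_congr rfl fun k _ => ?_
      congr 1
      have ha := RingHom.map_mulVec Complex.ofRealHom A a k
      have hb := RingHom.map_mulVec Complex.ofRealHom B b k
      rw [Pi.add_apply, Pi.add_apply, ← ha, ← hb]
      simp
    rw [e1, Matrix.dotProduct_mulVec, Matrix.dotProduct_mulVec, hA, hB, zero_dotProduct, add_zero,
      smul_dotProduct, smul_eq_mul]
    rfl
  have hz : ∀ t ∈ Set.Icc 0 T, HasDerivWithinAt (fun t => ∑ k, v k * (x t k : ℂ))
      (μ * ∑ k, v k * (x t k : ℂ)) (Set.Icc 0 T) t := by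
    intro t ht
    rw [← key (x t) (u t)]
    refine HasDerivWithinAt.fun_sum fun k _ => ?_
    exact ((hasDerivWithinAt_pi.1 (hx t ht) k).ofReal_comp).const_mul (v k)
  -- the integrating factor makes `v ⬝ᵥ x` constant
  have hg : ∀ t ∈ Set.Icc 0 T, HasDerivWithinAt
      (fun t : ℝ => Complex.exp (-μ * t) * ∑ k, v k * (x t k : ℂ)) 0 (Set.Icc 0 T) t := by
    intro t ht
    have he : HasDerivAt (fun t : ℝ => Complex.exp (-μ * t)) (Complex.exp (-μ * t) * (-μ * 1)) t :=
      ((hasDerivAt_id t).ofReal_comp.const_mul (-μ)).cexp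
    refine (he.hasDerivWithinAt.mul (hz t ht)).congr_deriv ?_
    ring
  have hc := (convex_Icc 0 T).is_const_of_fderivWithin_eq_zero (𝕜 := ℝ)
    (fun t ht => (hg t ht).differentiableWithinAt)
    (fun t ht => by
      ext
      exact (hg t ht).derivWithin (uniqueDiffOn_Icc hT t ht))
    (Set.left_mem_Icc.2 hT.le) (Set.right_mem_Icc.2 hT.le)
  simp only [h0, h1, Pi.zero_apply, Complex.ofReal_zero, mul_zero, Finset.sum_const_zero] at hc
  rw [Finset.sum_eq_single r (fun k _ hk => by simp [Pi.single_eq_of_ne hk]) (by simp)] at hc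
  exact hr (by simpa using hc)

/-- If an endomorphism of a finite-dimensional complex space leaves `P` invariant and has no
eigenvector in `P ∩ ker g`, then the pair `(f, g)` is observable on `P`. -/
theorem eq_zero_of_forall_pow_of_no_eigenvector {V U : Type*} [AddCommGroup V] [Module ℂ V]
    [FiniteDimensional ℂ V] [AddCommGroup U] [Module ℂ U] (f : Module.End ℂ V) (g : V →ₗ[ℂ] U)
    (P : Submodule ℂ V) (hP : ∀ v ∈ P, f v ∈ P)
    (h : ∀ (μ : ℂ), ∀ v ∈ P, f v = μ • v → g v = 0 → v = 0)
    {v : V} (hv : v ∈ P) (hg : ∀ k : ℕ, g ((f ^ k) v) = 0) : v = 0 := by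
  let N : Submodule ℂ V := P ⊓ ⨅ k : ℕ, LinearMap.ker (g ∘ₗ (f ^ k))
  have memN : ∀ w, w ∈ N ↔ w ∈ P ∧ ∀ k : ℕ, g ((f ^ k) w) = 0 := by
    intro w; simp [N, Submodule.mem_iInf]
  have hN : ∀ w ∈ N, f w ∈ N := by
    intro w hw
    rw [memN] at hw ⊢
    refine ⟨hP w hw.1, fun k => ?_⟩
    simpa [pow_succ] using hw.2 (k + 1)
  by_contra hne
  have : Nontrivial N := ⟨⟨⟨v, (memN v).2 ⟨hv, hg⟩⟩, 0, fun hh => hne (congrArg Subtype.val hh)⟩⟩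
  obtain ⟨μ, hμ⟩ := Module.End.exists_eigenvalue (f.restrict hN)
  obtain ⟨w, hw⟩ := hμ.exists_hasEigenvector
  have hwN := (memN w.1).1 w.2
  have := h μ w.1 hwN.1 (congrArg Subtype.val hw.apply_eq_smul) (by simpa using hwN.2 0)
  exact hw.2 (Subtype.ext this)

section Steering

open NormedSpace MeasureTheory intervalIntegral

variable {V U : Type*} [NormedAddCommGroup V] [NormedSpace ℝ V] [FiniteDimensional ℝ V]
  [NormedAddCommGroup U] [NormedSpace ℝ U]

theorem hasDerivAt_exp_smul_clm (T : V →L[ℝ] V) (t : ℝ) :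
    HasDerivAt (fun t : ℝ => exp (t • T)) (T * exp (t • T)) t :=
  have : CompleteSpace V := FiniteDimensional.complete ℝ V
  hasDerivAt_exp_smul_const' T t

theorem continuous_exp_smul_clm (T : V →L[ℝ] V) : Continuous fun t : ℝ => exp (t • T) :=
  continuous_iff_continuousAt.2 fun t => (hasDerivAt_exp_smul_clm T t).continuousAt

theorem exp_smul_mul_exp_neg_smul (T : V →L[ℝ] V) (t : ℝ) :
    exp (t • T) * exp ((-t) • T) = 1 := by
  have : CompleteSpace V := FiniteDimensional.complete ℝ V
  let : NormedAlgebra ℚ (V →L[ℝ] V) := NormedAlgebra.restrictScalars ℚ ℝ _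
  rw [neg_smul, ← exp_add_of_commute (Commute.neg_right (Commute.refl _)), add_neg_cancel,
    exp_zero]

theorem continuous_exp_neg_smul_apply (T : V →L[ℝ] V) (G : U →L[ℝ] V) {u : ℝ → U}
    (hu : Continuous u) : Continuous fun s : ℝ => exp ((-s) • T) (G (u s)) :=
  ((continuous_exp_smul_clm T).comp continuous_neg).clm_apply (G.continuous.comp hu)

/-- If `(T, G)` satisfies the Kalman condition, every vector has the form
`∫ s in 0..1, e^{-sT} G u(s)` with a continuous input `u`. -/
theorem exists_input_integral_eq (T : V →L[ℝ] V) (G : (ι → ℝ) →L[ℝ] V)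
    (h : ∀ l : Module.Dual ℝ V, (∀ (k : ℕ) (b : ι → ℝ), l ((T ^ k) (G b)) = 0) → l = 0) (w : V) :
    ∃ u : ℝ → ι → ℝ, Continuous u ∧ ∫ s in (0 : ℝ)..1, exp ((-s) • T) (G (u s)) = w := by
  have : CompleteSpace V := FiniteDimensional.complete ℝ V
  let R : Submodule ℝ V :=
    { carrier := {w | ∃ u : ℝ → ι → ℝ, Continuous u ∧
        ∫ s in (0 : ℝ)..1, exp ((-s) • T) (G (u s)) = w}
      add_mem' := by
        rintro _ _ ⟨u, hu, rfl⟩ ⟨u', hu', rfl⟩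
        refine ⟨fun s => u s + u' s, hu.add hu', ?_⟩
        simp only [map_add]
        exact integral_add ((continuous_exp_neg_smul_apply T G hu).intervalIntegrable _ _)
          ((continuous_exp_neg_smul_apply T G hu').intervalIntegrable _ _)
      zero_mem' := ⟨0, continuous_zero, by simp⟩
      smul_mem' := by
        rintro c _ ⟨u, hu, rfl⟩
        refine ⟨fun s => c • u s, hu.const_smul c, ?_⟩
        simp only [map_smul]
        exact integral_smul _ _ }
  suffices hR : R = ⊤ by
    have : w ∈ R := hR ▸ Submodule.mem_top
    exact this
  by_contra hR
  obtain ⟨l, hl, hlR⟩ := Submodule.exists_le_ker_of_lt_top R (lt_top_iff_ne_top.2 hR)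
  refine hl (h l ?_)
  let L : V →L[ℝ] ℝ := LinearMap.toContinuousLinearMap l
  have hcont : ∀ b : ι → ℝ, Continuous fun s : ℝ => L (exp ((-s) • T) (G b)) := fun b =>
    L.continuous.comp (continuous_exp_neg_smul_apply T G continuous_const)
  -- testing `l` on the input `s ↦ l (e^{-sT} G b) • b` gives the integral of a square
  have hzero : ∀ b : ι → ℝ, ∀ s ∈ Set.Icc (0 : ℝ) 1, L (exp ((-s) • T) (G b)) = 0 := by
    intro b
    by_contra! hne
    obtain ⟨c, hc, hcne⟩ := hne
    have hu : Continuous fun s : ℝ => L (exp ((-s) • T) (G b)) • b :=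
      (hcont b).smul continuous_const
    have h0 : L (∫ s in (0 : ℝ)..1, exp ((-s) • T) (G (L (exp ((-s) • T) (G b)) • b))) = 0 :=
      hlR ⟨_, hu, rfl⟩
    rw [← L.intervalIntegral_comp_comm
      ((continuous_exp_neg_smul_apply T G hu).intervalIntegrable _ _)] at h0
    simp only [map_smul, smul_eq_mul] at h0
    have hpos := intervalIntegral.integral_pos one_pos
      ((hcont b).mul (hcont b)).continuousOn (fun s _ => mul_self_nonneg _)
      ⟨c, hc, mul_self_pos.2 hcne⟩
    exact hpos.ne' h0
  -- differentiating repeatedly inserts powers of `T`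
  have hpow : ∀ k : ℕ, ∀ b : ι → ℝ, ∀ s ∈ Set.Ioo (0 : ℝ) 1,
      L (exp ((-s) • T) ((T ^ k) (G b))) = 0 := by
    intro k b
    induction k with
    | zero => exact fun s hs => hzero b s (Set.Ioo_subset_Icc_self hs)
    | succ k ih =>
      intro s hs
      have hd : HasDerivAt (fun s : ℝ => L (exp ((-s) • T) ((T ^ k) (G b))))
          (L (((-1 : ℝ) • (exp ((-s) • T) * T)) ((T ^ k) (G b)))) s := by
        have h1 : HasDerivAt (fun s : ℝ => exp (s • T)) (exp ((-s) • T) * T) (-s) :=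
          hasDerivAt_exp_smul_const T (-s)
        have h2 := (h1.scomp s (hasDerivAt_neg s)).clm_apply
          (hasDerivAt_const s ((T ^ k) (G b)))
        simp only [map_zero, add_zero] at h2
        exact L.hasFDerivAt.comp_hasDerivAt s h2
      have hd0 : HasDerivAt (fun s : ℝ => L (exp ((-s) • T) ((T ^ k) (G b)))) 0 s :=
        (hasDerivAt_const s (0 : ℝ)).congr_of_eventuallyEq
          (Filter.eventuallyEq_of_mem (isOpen_Ioo.mem_nhds hs) ih)
      have := hd.unique hd0
      rw [pow_succ']
      simpa using this
  have hhalf : l ∘ₗ (exp ((-(1 / 2) : ℝ) • T)).toLinearMap = 0 := by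
    refine h _ fun k b => hpow k b (1 / 2) (by norm_num)
  intro k b
  have hinv : (exp ((-(1 / 2) : ℝ) • T)) ((exp ((1 / 2 : ℝ) • T)) ((T ^ k) (G b))) =
      (T ^ k) (G b) := by
    have := exp_smul_mul_exp_neg_smul T (-(1 / 2))
    rw [neg_neg] at this
    exact DFunLike.congr_fun this _
  rw [← hinv]
  exact LinearMap.congr_fun hhalf _

/-- Under the Kalman condition every state can be steered to every state in unit time. -/
theorem exists_steering (T : V →L[ℝ] V) (G : (ι → ℝ) →L[ℝ] V)
    (h : ∀ l : Module.Dual ℝ V, (∀ (k : ℕ) (b : ι → ℝ), l ((T ^ k) (G b)) = 0) → l = 0)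
    (x₀ x₁ : V) :
    ∃ (u : ℝ → ι → ℝ) (x : ℝ → V), Continuous u ∧ x 0 = x₀ ∧ x 1 = x₁ ∧
      ∀ t, HasDerivAt x (T (x t) + G (u t)) t := by
  have : CompleteSpace V := FiniteDimensional.complete ℝ V
  obtain ⟨u, hu, hint⟩ := exists_input_integral_eq T G h (exp ((-1 : ℝ) • T) x₁ - x₀)
  -- the variation of constants formula
  refine ⟨u, fun t => exp (t • T) (x₀ + ∫ s in (0 : ℝ)..t, exp ((-s) • T) (G (u s))), hu,
    by simp, ?_, fun t => ?_⟩
  · simp only [hint, add_sub_cancel]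
    exact DFunLike.congr_fun (exp_smul_mul_exp_neg_smul T 1) x₁
  · have hi := ((continuous_exp_neg_smul_apply T G hu).integral_hasStrictDerivAt 0 t).hasDerivAt
    refine ((hasDerivAt_exp_smul_clm T t).clm_apply (hi.const_add x₀)).congr_deriv ?_
    congr 1
    exact DFunLike.congr_fun (exp_smul_mul_exp_neg_smul T t) (G (u t))

end Steering

/-- The Hautus test: without a complex left eigenvector of `A` in the left kernel of `B`, the
system is controllable. -/
theorem controllable_of_forall_left_eigenvector {A : Matrix (Fin n) (Fin n) ℝ}
    {B : Matrix (Fin n) ι ℝ}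
    (h : ∀ (μ : ℂ) (v : Fin n → ℂ), v ᵥ* A.map Complex.ofRealHom = μ • v →
      v ᵥ* B.map Complex.ofRealHom = 0 → v = 0) : Controllable A B := by
  classical
  let T : (Fin n → ℝ) →L[ℝ] (Fin n → ℝ) := LinearMap.toContinuousLinearMap A.mulVecLin
  let G : (ι → ℝ) →L[ℝ] (Fin n → ℝ) := LinearMap.toContinuousLinearMap B.mulVecLin
  have hTk : ∀ (k : ℕ) (w : Fin n → ℝ), (T ^ k) w = (A ^ k) *ᵥ w := by
    intro k
    induction k with
    | zero => simp
    | succ k ih =>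
      intro w
      rw [pow_succ, pow_succ, ← Matrix.mulVec_mulVec, ← ih]
      rfl
  have hK : ∀ l : Module.Dual ℝ (Fin n → ℝ),
      (∀ (k : ℕ) (b : ι → ℝ), l ((T ^ k) (G b)) = 0) → l = 0 := by
    intro l hl
    let v : Fin n → ℝ := fun i => l (Pi.single i 1)
    have hlv : ∀ w, l w = v ⬝ᵥ w := by
      intro w
      conv_lhs => rw [pi_eq_sum_univ' w]
      simp [v, dotProduct, mul_comm]
    have hv : ∀ k : ℕ, v ᵥ* (A ^ k) ᵥ* B = 0 := by
      intro k
      ext j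
      have h1 := hl k (Pi.single j 1)
      rw [hlv, hTk, Matrix.dotProduct_mulVec] at h1
      change v ᵥ* A ^ k ⬝ᵥ B *ᵥ Pi.single j 1 = 0 at h1
      rw [Matrix.dotProduct_mulVec] at h1
      simpa using h1
    let f : Module.End ℂ (Fin n → ℂ) := (A.map Complex.ofRealHom).vecMulLinear
    have hf : ∀ (k : ℕ) (w : Fin n → ℝ),
        (f ^ k) (Complex.ofRealHom ∘ w) = Complex.ofRealHom ∘ (w ᵥ* (A ^ k)) := by
      intro k
      induction k with
      | zero => simp
      | succ k ih =>
        intro w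
        rw [pow_succ, pow_succ', Module.End.mul_apply, ← Matrix.vecMul_vecMul, ← ih]
        congr 1
        ext i
        exact (RingHom.map_vecMul Complex.ofRealHom A w i).symm
    have hz := eq_zero_of_forall_pow_of_no_eigenvector f (B.map Complex.ofRealHom).vecMulLinear
      ⊤ (by simp) (fun μ w _ => h μ w) (v := Complex.ofRealHom ∘ v) trivial (fun k => by
        rw [hf]
        ext i
        refine (RingHom.map_vecMul Complex.ofRealHom B _ i).symm.trans ?_
        rw [hv]; simp)
    refine LinearMap.ext fun w => ?_
    have hv0 : v = 0 := by
      ext i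
      simpa using congrFun hz i
    rw [hlv, hv0]; simp
  intro x₀ x₁
  obtain ⟨u, x, hu, h0, h1, hx⟩ := exists_steering T G hK x₀ x₁
  exact ⟨1, one_pos, u, x, hu.continuousOn, h0, h1, fun t _ => (hx t).hasDerivWithinAt⟩

end Hautus

/-! ### Source components of the state digraph -/

section Components

variable {n : ℕ} {Abar : StructMatrix n (Fin n)}

/-- A non-empty set of states without entering edges contains a non-top linked component: the
component of a state of the set with the fewest ancestors. -/
theorem exists_isNonTopLinked_subset {D : Set (Fin n)} (hne : D.Nonempty)
    (hD : ∀ j i, StateEdge Abar j i → i ∈ D → j ∈ D) : ∃ C, IsNonTopLinked Abar C ∧ C ⊆ D := by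
  classical
  let anc : Fin n → Finset (Fin n) := fun v => {w | Reaches Abar w v}
  have hanc : ∀ v w, w ∈ anc v ↔ Reaches Abar w v := by simp [anc]
  obtain ⟨v, hvD, hmin⟩ := Set.exists_min_image D (fun v => (anc v).card) D.toFinite hne
  have hclosed : ∀ w u, Reaches Abar w u → u ∈ D → w ∈ D := by
    intro w u h
    induction h with
    | refl => exact id
    | tail _ hbc ih => exact fun hc => ih (hD _ _ hbc hc)
  have hback : ∀ w, Reaches Abar w v → Reaches Abar v w := by
    intro w hw
    have hsub : anc w ⊆ anc v := fun a ha =>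
      (hanc _ _).2 (Relation.ReflTransGen.trans ((hanc _ _).1 ha) hw)
    have heq := Finset.eq_of_subset_of_card_le hsub (hmin w (hclosed w v hw hvD))
    exact (hanc _ _).1 (heq ▸ (hanc v v).2 Relation.ReflTransGen.refl)
  refine ⟨{w | Reaches Abar v w ∧ Reaches Abar w v}, ⟨⟨v, rfl⟩, fun j i hji hi => ?_⟩,
    fun w hw => hclosed w v hw.2 hvD⟩
  have hjv : Reaches Abar j v := Relation.ReflTransGen.head hji hi.2
  exact ⟨hback j hjv, hjv⟩

theorem IsNonTopLinked.nonempty {C : Set (Fin n)} (h : IsNonTopLinked Abar C) : C.Nonempty := by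
  obtain ⟨v, rfl⟩ := h.1
  exact ⟨v, Relation.ReflTransGen.refl, Relation.ReflTransGen.refl⟩

theorem IsNonTopLinked.eq_of_mem {C C' : Set (Fin n)} (h : IsNonTopLinked Abar C)
    (h' : IsNonTopLinked Abar C') {r : Fin n} (hr : r ∈ C) (hr' : r ∈ C') : C = C' := by
  obtain ⟨v, rfl⟩ := h.1
  obtain ⟨v', rfl⟩ := h'.1
  have h1 : Reaches Abar v v' := hr.1.trans hr'.2
  have h2 : Reaches Abar v' v := hr'.1.trans hr.2
  ext w
  exact ⟨fun hw => ⟨h2.trans hw.1, hw.2.trans h1⟩, fun hw => ⟨h1.trans hw.1, hw.2.trans h2⟩⟩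

end Components

/-! ### Necessity in Lin's theorem -/

section Lin

variable {n : ℕ} {ι : Type}

theorem vecMul_apply_eq_sum {α β R : Type*} [Fintype α] [NonUnitalNonAssocSemiring R]
    (v : α → R) (M : Matrix α β R) (c : β) : (v ᵥ* M) c = ∑ i, v i * M i c := rfl

/-- The pattern `[Abar Bbar]`: whether the state or input `c` is an in-neighbour of the
state `k`. -/
def inEdge (Abar : StructMatrix n (Fin n)) (Bbar : StructMatrix n ι) :
    Fin n → Fin n ⊕ ι → Bool :=
  fun k => Sum.elim (Abar k) (Bbar k)

variable {Abar : StructMatrix n (Fin n)} {Bbar : StructMatrix n ι}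

theorem StructurallyControllable.exists_input [Fintype ι] (h : StructurallyControllable Abar Bbar)
    {C : Set (Fin n)} (hC : IsNonTopLinked Abar C) : ∃ r ∈ C, ∃ j, Bbar r j = true := by
  classical
  obtain ⟨A, B, hA, hB, hc⟩ := h
  by_contra! hno
  -- no edge enters `C`, so the row vectors supported on `C` form an invariant subspace in `ker B`
  let P : Submodule ℂ (Fin n → ℂ) :=
    { carrier := {v | ∀ k, k ∉ C → v k = 0}
      add_mem' := fun ha hb k hk => by simp [ha k hk, hb k hk]
      zero_mem' := fun _ _ => rfl
      smul_mem' := fun c v hv k hk => by simp [hv k hk] }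
  have hP : ∀ v ∈ P, (A.map Complex.ofRealHom).vecMulLinear v ∈ P := by
    intro v hv k hk
    rw [Matrix.vecMulLinear_apply, vecMul_apply_eq_sum]
    refine Finset.sum_eq_zero fun i _ => ?_
    by_cases hi : i ∈ C
    · have : A i k = 0 := hA i k (by
        by_contra hne
        exact hk (hC.2 k i (by simpa [StateEdge] using hne) hi))
      simp [this]
    · simp [hv i hi]
  have hker : ∀ v ∈ P, v ᵥ* B.map Complex.ofRealHom = 0 := by
    intro v hv
    ext j
    rw [vecMul_apply_eq_sum]
    refine Finset.sum_eq_zero fun i _ => ?_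
    by_cases hi : i ∈ C
    · have : B i j = 0 := hB i j (by simpa using hno i hi j)
      simp [this]
    · simp [hv i hi]
  obtain ⟨r, hr⟩ := hC.nonempty
  have hmem : (Pi.single r 1 : Fin n → ℂ) ∈ P := fun k hk =>
    Pi.single_eq_of_ne (by rintro rfl; exact hk hr) _
  have hz := eq_zero_of_forall_pow_of_no_eigenvector (A.map Complex.ofRealHom).vecMulLinear
    (0 : (Fin n → ℂ) →ₗ[ℂ] ℂ) P hP
    (fun μ v hv hAv _ => hc.eq_zero_of_left_eigenvector hAv (hker v hv)) hmem (fun _ => rfl)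
  simpa using congrFun hz r

/-- A Hall violator would be a set of rows of `[A B]` too large to be independent, that is, a left
eigenvector for the eigenvalue `0` in the left kernel of `B`. -/
theorem StructurallyControllable.exists_matching [Fintype ι]
    (h : StructurallyControllable Abar Bbar) :
    ∃ φ : Fin n → Fin n ⊕ ι, Function.Injective φ ∧ ∀ k, inEdge Abar Bbar k (φ k) = true := by
  classical
  obtain ⟨A, B, hA, hB, hc⟩ := h
  let t : Fin n → Finset (Fin n ⊕ ι) := fun k => {c | inEdge Abar Bbar k c = true}
  have hall : ∀ X : Finset (Fin n), X.card ≤ (X.biUnion t).card := by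
    intro X
    by_contra! hlt
    let M : Matrix (Fin n) (Fin n ⊕ ι) ℂ :=
      Matrix.fromCols (A.map Complex.ofRealHom) (B.map Complex.ofRealHom)
    have hM : ∀ k c, inEdge Abar Bbar k c = false → M k c = 0 := by
      rintro k (r | j) hkc
      · simpa [M] using hA k r hkc
      · simpa [M] using hB k j hkc
    let N : Matrix X (X.biUnion t) ℂ := fun k c => M k c
    have hker : LinearMap.ker N.vecMulLinear ≠ ⊥ :=
      LinearMap.ker_ne_bot_of_finrank_lt (by
        rwa [Module.finrank_fintype_fun_eq_card, Module.finrank_fintype_fun_eq_card,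
          Fintype.card_coe, Fintype.card_coe])
    obtain ⟨w, hw, hw0⟩ := (Submodule.ne_bot_iff _).1 hker
    let v : Fin n → ℂ := fun k => if hk : k ∈ X then w ⟨k, hk⟩ else 0
    have hsum : ∀ c, (v ᵥ* M) c = ∑ k : X, w k * M k c := by
      intro c
      rw [vecMul_apply_eq_sum, ← Finset.sum_subset (Finset.subset_univ X)
        (fun k _ hk => by simp [v, hk]), ← Finset.sum_coe_sort]
      exact Finset.sum_congr rfl fun k _ => by simp [v]
    have hv : v ᵥ* M = 0 := by
      ext c
      rw [hsum]
      by_cases hcX : c ∈ X.biUnion t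
      · exact congrFun hw ⟨c, hcX⟩
      · refine Finset.sum_eq_zero fun k _ => ?_
        rw [hM k c, mul_zero]
        by_contra hne
        exact hcX (Finset.mem_biUnion.2 ⟨k, k.2, by simpa [t] using hne⟩)
    have hv0 : v = 0 := by
      refine hc.eq_zero_of_left_eigenvector (μ := 0) ?_ ?_
      · ext r
        exact (congrFun hv (Sum.inl r)).trans (zero_mul (v r)).symm
      · ext j
        exact congrFun hv (Sum.inr j)
    refine hw0 (funext fun k => ?_)
    simpa [v] using congrFun hv0 k
  obtain ⟨φ, hφ, hφt⟩ := (Finset.all_card_le_biUnion_card_iff_exists_injective t).1 hall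
  exact ⟨φ, hφ, fun k => by simpa [t] using hφt k⟩

/-! ### Sufficiency in Lin's theorem -/

/-- A resolvent estimate. Let `e` be visible through `G` after finitely many steps of `T`. For `μ`
of large modulus the solution `v` of `T v + a • e = μ • v` is small compared to `a`, whereas `G v = 0`
makes `G (T ^ (i + 1) v)` a fixed non-zero vector times `a` for some `i`. -/
theorem exists_bound_of_observable {V U : Type*} [NormedAddCommGroup V] [NormedSpace ℂ V]
    [NormedAddCommGroup U] [NormedSpace ℂ U] (T : V →L[ℂ] V) (G : V →L[ℂ] U) {e : V}
    (he : ∃ k : ℕ, G ((T ^ k) e) ≠ 0) :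
    ∃ R : ℝ, ∀ μ : ℂ, R < ‖μ‖ → ∀ (v : V) (a : ℂ), T v + a • e = μ • v → G v = 0 →
      a = 0 ∧ v = 0 := by
  classical
  obtain ⟨i, hi, hmin⟩ : ∃ i, G ((T ^ i) e) ≠ 0 ∧ ∀ j < i, G ((T ^ j) e) = 0 :=
    ⟨Nat.find he, Nat.find_spec he, fun j hj => not_not.1 (Nat.find_min he hj)⟩
  have hκ : 0 < ‖G ((T ^ i) e)‖ := norm_pos_iff.2 hi
  set κ := ‖G ((T ^ i) e)‖
  set M := ‖G.comp (T ^ (i + 1))‖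
  refine ⟨‖T‖ + M * ‖e‖ / κ, fun μ hμ v a hv hG => ?_⟩
  have hTv : T v = μ • v - a • e := eq_sub_of_add_eq hv
  have hstep : ∀ j, G ((T ^ (j + 1)) v) = μ • G ((T ^ j) v) - a • G ((T ^ j) e) := by
    intro j
    rw [pow_succ]
    change G ((T ^ j) (T v)) = _
    rw [hTv, map_sub, map_sub, map_smul, map_smul, map_smul, map_smul]
  -- `e` stays invisible before step `i`, hence so does `v`
  have hzero : ∀ j ≤ i, G ((T ^ j) v) = 0 := by
    intro j
    induction j with
    | zero => simpa using hG
    | succ j ih =>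
      intro hj
      rw [hstep, ih (by omega), hmin j (by omega)]
      simp
  have h1 : ‖a‖ * κ ≤ M * ‖v‖ := by
    have h2 : G ((T ^ (i + 1)) v) = -(a • G ((T ^ i) e)) := by
      rw [hstep, hzero i le_rfl]; simp
    calc ‖a‖ * κ = ‖G.comp (T ^ (i + 1)) v‖ := by
          rw [ContinuousLinearMap.comp_apply, h2, norm_neg, norm_smul]
      _ ≤ M * ‖v‖ := ContinuousLinearMap.le_opNorm _ _
  have h2 : ‖μ‖ * ‖v‖ ≤ ‖T‖ * ‖v‖ + ‖a‖ * ‖e‖ := by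
    rw [← norm_smul, ← hv, ← norm_smul a e]
    exact (norm_add_le _ _).trans (by gcongr; exact T.le_opNorm v)
  have hv0 : v = 0 := by
    by_contra hne
    have hvpos : 0 < ‖v‖ := norm_pos_iff.2 hne
    have h3 : ‖a‖ ≤ M * ‖v‖ / κ := (le_div_iff₀ hκ).2 h1
    have h4 : ‖μ‖ * ‖v‖ ≤ (‖T‖ + M * ‖e‖ / κ) * ‖v‖ := by
      calc ‖μ‖ * ‖v‖ ≤ ‖T‖ * ‖v‖ + ‖a‖ * ‖e‖ := h2
        _ ≤ ‖T‖ * ‖v‖ + M * ‖v‖ / κ * ‖e‖ := by gcongr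
        _ = _ := by ring
    exact absurd (lt_of_mul_lt_mul_right (h4.trans_lt' (by gcongr)) hvpos.le) (lt_irrefl _)
  subst hv0
  refine ⟨?_, rfl⟩
  have : ‖a‖ * κ ≤ 0 := by simpa using h1
  exact norm_eq_zero.1 (le_antisymm (nonpos_of_mul_nonpos_left this hκ) (norm_nonneg a))

/-- A realization `M` of the pattern `[Abar Bbar]` restricted to a set `S` of states closed under
the matching `φ`, satisfying the Hautus test on `S`. The test at the eigenvalue `0` is kept in the
stronger form that the columns matched into `S` are independent. -/
structure IsPartialRealization (Abar : StructMatrix n (Fin n)) (Bbar : StructMatrix n ι)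
    (φ : Fin n → Fin n ⊕ ι) (S : Finset (Fin n)) (M : Matrix (Fin n) (Fin n ⊕ ι) ℝ) : Prop where
  eq_zero : ∀ k c, inEdge Abar Bbar k c = false → M k c = 0
  row : ∀ k ∉ S, ∀ c, M k c = 0
  col : ∀ r ∉ S, ∀ k, M k (Sum.inl r) = 0
  closed : ∀ k ∈ S, ∀ r, φ k = Sum.inl r → r ∈ S
  rank : ∀ v : Fin n → ℂ, (∀ k ∉ S, v k = 0) →
    (∀ k ∈ S, (v ᵥ* M.map Complex.ofRealHom) (φ k) = 0) → v = 0
  hautus : ∀ μ : ℂ, μ ≠ 0 → ∀ v : Fin n → ℂ, (∀ k ∉ S, v k = 0) →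
    (∀ r, (v ᵥ* M.map Complex.ofRealHom) (Sum.inl r) = μ * v r) →
    (∀ j, (v ᵥ* M.map Complex.ofRealHom) (Sum.inr j) = 0) → v = 0

namespace IsPartialRealization

variable {φ : Fin n → Fin n ⊕ ι} {S : Finset (Fin n)} {M : Matrix (Fin n) (Fin n ⊕ ι) ℝ}

theorem vecMul_inl_eq_zero (h : IsPartialRealization Abar Bbar φ S M) (v : Fin n → ℂ) {r : Fin n}
    (hr : r ∉ S) : (v ᵥ* M.map Complex.ofRealHom) (Sum.inl r) = 0 :=
  (vecMul_apply_eq_sum _ _ _).trans <| Finset.sum_eq_zero fun i _ => by simp [h.col r hr i]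

theorem vecMul_congr (h : IsPartialRealization Abar Bbar φ S M) {v w : Fin n → ℂ}
    (hvw : ∀ k ∈ S, v k = w k) : v ᵥ* M.map Complex.ofRealHom = w ᵥ* M.map Complex.ofRealHom := by
  ext c
  rw [vecMul_apply_eq_sum, vecMul_apply_eq_sum]
  refine Finset.sum_congr rfl fun i _ => ?_
  by_cases hi : i ∈ S
  · rw [hvw i hi]
  · simp [h.row i hi]

/-- The Hautus test at all eigenvalues. -/
theorem eq_zero_of_left_eigenvector (h : IsPartialRealization Abar Bbar φ S M) {μ : ℂ}
    {v : Fin n → ℂ} (hv : ∀ k ∉ S, v k = 0)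
    (hA : ∀ r, (v ᵥ* M.map Complex.ofRealHom) (Sum.inl r) = μ * v r)
    (hB : ∀ j, (v ᵥ* M.map Complex.ofRealHom) (Sum.inr j) = 0) : v = 0 := by
  by_cases hμ : μ = 0
  · refine h.rank v hv fun k _ => ?_
    rcases φ k with r | j
    · simpa [hμ] using hA r
    · exact hB j
  · exact h.hautus μ hμ v hv hA hB

/-- The resolvent estimate on `S`: a vector with entry `a` at a state that hangs off `c` cannot
satisfy the eigenvector equations for an eigenvalue of large modulus unless `a = 0`. -/
theorem exists_bound [Fintype ι] [DecidableEq ι] (h : IsPartialRealization Abar Bbar φ S M)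
    {c : Fin n ⊕ ι} (hc : ∀ r, c = Sum.inl r → r ∈ S) :
    ∃ R : ℝ, ∀ μ : ℂ, R < ‖μ‖ → ∀ (v : Fin n → ℂ) (a : ℂ), (∀ k ∉ S, v k = 0) →
      (∀ r, (v ᵥ* M.map Complex.ofRealHom + (Pi.single c a : Fin n ⊕ ι → ℂ)) (Sum.inl r) =
        μ * v r) →
      (∀ j, (v ᵥ* M.map Complex.ofRealHom + (Pi.single c a : Fin n ⊕ ι → ℂ)) (Sum.inr j) = 0) →
      a = 0 := by
  let T₀ : Module.End ℂ (Fin n → ℂ) :=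
    ((M.map Complex.ofRealHom).submatrix id Sum.inl).vecMulLinear
  let G₀ : (Fin n → ℂ) →ₗ[ℂ] (ι → ℂ) :=
    ((M.map Complex.ofRealHom).submatrix id Sum.inr).vecMulLinear
  let T := LinearMap.toContinuousLinearMap T₀
  let G := LinearMap.toContinuousLinearMap G₀
  have hT : ∀ v r, T v r = (v ᵥ* M.map Complex.ofRealHom) (Sum.inl r) := fun _ _ => rfl
  have hG : ∀ v j, G v j = (v ᵥ* M.map Complex.ofRealHom) (Sum.inr j) := fun _ _ => rfl
  rcases c with y | j
  · have hy : y ∈ S := hc y rfl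
    let P : Submodule ℂ (Fin n → ℂ) :=
      { carrier := {v | ∀ k, k ∉ S → v k = 0}
        add_mem' := fun ha hb k hk => by simp [ha k hk, hb k hk]
        zero_mem' := fun _ _ => rfl
        smul_mem' := fun c v hv k hk => by simp [hv k hk] }
    have he : ∃ k : ℕ, G ((T ^ k) (Pi.single y 1)) ≠ 0 := by
      by_contra! hno
      have hTk : ∀ (k : ℕ) v, (T ^ k) v = (T₀ ^ k) v := by
        intro k
        induction k with
        | zero => simp
        | succ k ih =>
          intro v
          rw [pow_succ, pow_succ, Module.End.mul_apply, ← ih]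
          rfl
      have hz := eq_zero_of_forall_pow_of_no_eigenvector T₀ G₀ P
        (fun v _ k hk => h.vecMul_inl_eq_zero v hk)
        (fun μ v hv hTv hGv => h.eq_zero_of_left_eigenvector hv
          (fun r => congrFun hTv r) (fun j => congrFun hGv j))
        (v := Pi.single y 1)
        (fun k hk => Pi.single_eq_of_ne (by rintro rfl; exact hk hy) _)
        (fun k => by rw [← hTk]; exact hno k)
      simpa using congrFun hz y
    obtain ⟨R, hR⟩ := exists_bound_of_observable T G he
    refine ⟨R, fun μ hμ v a _ hA hB => (hR μ hμ v a ?_ ?_).1⟩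
    · ext r
      have := hA r
      simp only [Pi.add_apply, ← hT] at this
      simpa [Pi.single_apply] using this
    · ext j
      simpa [hG] using hB j
  · refine ⟨‖T‖, fun μ hμ v a _ hA hB => ?_⟩
    have hTv : T v = μ • v := by
      ext r
      simpa [hT] using hA r
    have hv0 : v = 0 := by
      by_contra hne
      have hle : ‖μ‖ * ‖v‖ ≤ ‖T‖ * ‖v‖ := by
        rw [← norm_smul, ← hTv]
        exact T.le_opNorm v
      exact absurd (le_of_mul_le_mul_right hle (norm_pos_iff.2 hne)) (not_le.2 hμ)
    simpa [hv0] using hB j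

theorem zero_empty : IsPartialRealization Abar Bbar φ ∅ 0 where
  eq_zero _ _ _ := rfl
  row _ _ _ := rfl
  col _ _ _ := rfl
  closed _ hk := absurd hk (Finset.notMem_empty _)
  rank _ hv _ := funext fun k => hv k (Finset.notMem_empty k)
  hautus _ _ _ hv _ _ := funext fun k => hv k (Finset.notMem_empty k)

/-- Appending to `S` a state whose matched in-neighbour is an input or lies in `S`. As the new
state has no out-neighbour, it only matters for the eigenvalue `0`. -/
theorem exists_insert [DecidableEq ι] (h : IsPartialRealization Abar Bbar φ S M)
    (hφ : Function.Injective φ) {k : Fin n} (hk : k ∉ S)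
    (hedge : inEdge Abar Bbar k (φ k) = true) (hc : ∀ r, φ k = Sum.inl r → r ∈ S) :
    ∃ M', IsPartialRealization Abar Bbar φ (insert k S) M' := by
  classical
  let M' : Matrix (Fin n) (Fin n ⊕ ι) ℝ := fun i c => M i c + if i = k ∧ c = φ k then 1 else 0
  have hM' : ∀ i c, M' i c = M i c + if i = k ∧ c = φ k then 1 else 0 := fun _ _ => rfl
  have hmul : ∀ (v : Fin n → ℂ) c, (v ᵥ* M'.map Complex.ofRealHom) c =
      (v ᵥ* M.map Complex.ofRealHom) c + if c = φ k then v k else 0 := by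
    intro v c
    simp only [vecMul_apply_eq_sum, Matrix.map_apply, hM', map_add, mul_add,
      Finset.sum_add_distrib]
    congr 1
    rw [Finset.sum_eq_single k (fun i _ hi => by simp [hi]) (by simp)]
    by_cases hck : c = φ k <;> simp [hck]
  have hsupp : ∀ v : Fin n → ℂ, v k = 0 → (∀ i ∉ insert k S, v i = 0) → ∀ i ∉ S, v i = 0 := by
    intro v hvk hv i hi
    by_cases hik : i = k
    · exact hik ▸ hvk
    · exact hv i (by simp [hik, hi])
  refine ⟨M', ⟨fun i c hic => ?_, fun i hi c => ?_, fun r hr i => ?_, fun i hi r hir => ?_,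
    fun v hv hM => ?_, fun μ hμ v hv hA hB => ?_⟩⟩
  · have : ¬(i = k ∧ c = φ k) := by
      rintro ⟨rfl, rfl⟩
      simp [hedge] at hic
    simp [hM', h.eq_zero i c hic, this]
  · rw [Finset.mem_insert, not_or] at hi
    simp [hM', h.row i hi.2, hi.1]
  · rw [Finset.mem_insert, not_or] at hr
    have : Sum.inl r ≠ φ k := fun hrk => hr.2 (hc r hrk.symm)
    simp [hM', h.col r hr.2, this]
  · rcases Finset.mem_insert.1 hi with rfl | hi
    · exact Finset.mem_insert_of_mem (hc r hir)
    · exact Finset.mem_insert_of_mem (h.closed i hi r hir)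
  · have hw0 : (fun i => if i ∈ S then v i else 0) = 0 := by
      refine h.rank _ (fun i hi => if_neg hi) fun i hi => ?_
      rw [h.vecMul_congr (w := v) (fun j hj => if_pos hj)]
      have := hM i (Finset.mem_insert_of_mem hi)
      rwa [hmul, if_neg (fun hik => hk ((hφ hik : i = k) ▸ hi)), add_zero] at this
    have hvk : v k = 0 := by
      have := hM k (Finset.mem_insert_self k S)
      rw [hmul, if_pos rfl,
        h.vecMul_congr (w := 0) (fun j hj => by simpa [hj] using congrFun hw0 j)] at this
      simpa using this
    funext i
    by_cases hi : i ∈ S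
    · simpa [hi] using congrFun hw0 i
    · exact hsupp v hvk hv i hi
  · have hvk : v k = 0 := by
      have := hA k
      rw [hmul, h.vecMul_inl_eq_zero v hk, if_neg (fun hkk => hk (hc k hkk.symm)), add_zero] at this
      exact (mul_eq_zero.1 this.symm).resolve_left hμ
    have hsame : ∀ c, (v ᵥ* M'.map Complex.ofRealHom) c = (v ᵥ* M.map Complex.ofRealHom) c := by
      intro c
      simp [hmul, hvk]
    exact h.hautus μ hμ v (hsupp v hvk hv) (fun r => hsame _ ▸ hA r) (fun j => hsame _ ▸ hB j)

/-- Appending to `S` a set `C` of states that `φ` permutes as the single cycle through `k`, together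
with an edge from `c` to `k`. The cycle gets a large weight `γ`, so that its eigenvalues lie on
the circle of radius `γ`, where the resolvent estimate applies to the part on `S`. -/
theorem exists_union_cycle [Fintype ι] [DecidableEq ι]
    (h : IsPartialRealization Abar Bbar φ S M) (hφ : Function.Injective φ)
    {σ : Fin n → Fin n} {k : Fin n} {C : Finset (Fin n)} {L : ℕ} (hL : 0 < L)
    (hC : ∀ i, i ∈ C ↔ ∃ l : ℕ, σ^[l] k = i) (hper : σ^[L] k = k) (hCS : ∀ i ∈ C, i ∉ S)
    (hσ : ∀ i ∈ C, φ i = Sum.inl (σ i)) (hedge : ∀ i ∈ C, inEdge Abar Bbar i (φ i) = true)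
    {c : Fin n ⊕ ι} (hc : ∀ r, c = Sum.inl r → r ∈ S) (hkc : inEdge Abar Bbar k c = true) :
    ∃ M', IsPartialRealization Abar Bbar φ (S ∪ C) M' := by
  classical
  obtain ⟨R, hR⟩ := h.exists_bound hc
  obtain ⟨γ, hγR, hγ⟩ : ∃ γ : ℝ, R < γ ∧ 0 < γ :=
    ⟨max R 0 + 1, (le_max_left _ _).trans_lt (lt_add_one _),
      (le_max_right R 0).trans_lt (lt_add_one _)⟩
  have hγC : (γ : ℂ) ≠ 0 := Complex.ofReal_ne_zero.2 hγ.ne'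
  have hkC : k ∈ C := (hC k).2 ⟨0, rfl⟩
  have hσC : ∀ i ∈ C, σ i ∈ C := by
    intro i hi
    obtain ⟨l, rfl⟩ := (hC i).1 hi
    exact (hC _).2 ⟨l + 1, Function.iterate_succ_apply' σ l k⟩
  have hcC : ∀ r ∉ S, Sum.inl r ≠ c := fun r hr hrc => hr (hc r hrc.symm)
  let M' : Matrix (Fin n) (Fin n ⊕ ι) ℝ := fun i d =>
    M i d + ((if i ∈ C ∧ d = φ i then γ else 0) + if i = k ∧ d = c then 1 else 0)
  have hM' : ∀ i d, M' i d = M i d +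
      ((if i ∈ C ∧ d = φ i then γ else 0) + if i = k ∧ d = c then 1 else 0) := fun _ _ => rfl
  have hmul : ∀ (v : Fin n → ℂ) d, (v ᵥ* M'.map Complex.ofRealHom) d =
      (v ᵥ* M.map Complex.ofRealHom) d +
        ((∑ i, if i ∈ C ∧ d = φ i then v i * γ else 0) + if d = c then v k else 0) := by
    intro v d
    simp only [vecMul_apply_eq_sum, Matrix.map_apply, hM', map_add, mul_add,
      Finset.sum_add_distrib]
    congr 2
    · refine Finset.sum_congr rfl fun i _ => ?_
      split_ifs <;> simp
    · rw [Finset.sum_eq_single k (fun i _ hi => by simp [hi]) (by simp)]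
      by_cases hdc : d = c <;> simp [hdc]
  -- the column matched to a state of the cycle
  have hmulC : ∀ (v : Fin n → ℂ), ∀ i ∈ C,
      (v ᵥ* M'.map Complex.ofRealHom) (Sum.inl (σ i)) = v i * γ := by
    intro v i hi
    have hσi := hCS _ (hσC i hi)
    rw [hmul, h.vecMul_inl_eq_zero v hσi, if_neg (hcC _ hσi), zero_add, add_zero,
      Finset.sum_eq_single i _ (by simp), if_pos ⟨hi, (hσ i hi).symm⟩]
    rintro j - hji
    refine if_neg fun hj => hji (hφ ?_)
    rw [← hj.2, hσ i hi]
  -- a column that is matched to no state of the cycle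
  have hmulS : ∀ (v : Fin n → ℂ) d, (∀ i ∈ C, d ≠ φ i) → (v ᵥ* M'.map Complex.ofRealHom) d =
      (v ᵥ* M.map Complex.ofRealHom + (Pi.single c (v k) : Fin n ⊕ ι → ℂ)) d := by
    intro v d hd
    rw [hmul, Finset.sum_eq_zero fun i _ => if_neg fun hi => hd i hi.1 hi.2, zero_add,
      Pi.add_apply, Pi.single_apply]
  have hdS : ∀ r ∈ S, ∀ i ∈ C, (Sum.inl r : Fin n ⊕ ι) ≠ φ i := by
    intro r hr i hi hri
    rw [hσ i hi, Sum.inl.injEq] at hri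
    exact hCS _ (hσC i hi) (hri ▸ hr)
  have hsupp : ∀ v : Fin n → ℂ, (∀ i ∈ C, v i = 0) → (∀ i ∉ S ∪ C, v i = 0) →
      ∀ i ∉ S, v i = 0 := by
    intro v hvC hv i hi
    by_cases hiC : i ∈ C
    · exact hvC i hiC
    · exact hv i (by simp [hi, hiC])
  refine ⟨M', ⟨fun i d hid => ?_, fun i hi d => ?_, fun r hr i => ?_, fun i hi r hir => ?_,
    fun v hv hM => ?_, fun μ hμ v hv hA hB => ?_⟩⟩
  · have h1 : ¬(i ∈ C ∧ d = φ i) := by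
      rintro ⟨hi, rfl⟩
      simp [hedge i hi] at hid
    have h2 : ¬(i = k ∧ d = c) := by
      rintro ⟨rfl, rfl⟩
      simp [hkc] at hid
    simp [hM', h.eq_zero i d hid, h1, h2]
  · rw [Finset.mem_union, not_or] at hi
    have h2 : i ≠ k := fun hik => hi.2 (hik ▸ hkC)
    simp [hM', h.row i hi.1, hi.2, h2]
  · rw [Finset.mem_union, not_or] at hr
    have h1 : ¬(i ∈ C ∧ Sum.inl r = φ i) := by
      rintro ⟨hi, hri⟩
      rw [hσ i hi, Sum.inl.injEq] at hri
      exact hr.2 (hri ▸ hσC i hi)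
    simp [hM', h.col r hr.1, h1, hcC r hr.1]
  · rcases Finset.mem_union.1 hi with hi | hi
    · exact Finset.mem_union_left _ (h.closed i hi r hir)
    · rw [hσ i hi, Sum.inl.injEq] at hir
      exact Finset.mem_union_right _ (hir ▸ hσC i hi)
  · have hvC : ∀ i ∈ C, v i = 0 := by
      intro i hi
      have := hM i (Finset.mem_union_right _ hi)
      rw [hσ i hi, hmulC v i hi] at this
      exact (mul_eq_zero.1 this).resolve_right hγC
    refine h.rank v (hsupp v hvC hv) fun i hi => ?_
    have := hM i (Finset.mem_union_left _ hi)
    rw [hmulS v _ (fun j hj hij => hCS j hj (hφ hij ▸ hi)), hvC k hkC] at this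
    simpa using this
  · -- along the cycle the eigenvector equation is a geometric recursion
    have hiter : ∀ l : ℕ, v (σ^[l] k) = (γ / μ) ^ l * v k := by
      intro l
      induction l with
      | zero => simp
      | succ l ih =>
        have hl : σ^[l] k ∈ C := (hC _).2 ⟨l, rfl⟩
        have := hA (σ (σ^[l] k))
        rw [hmulC v _ hl, ih] at this
        rw [Function.iterate_succ_apply', pow_succ]
        field_simp
        rw [mul_comm, ← this]
        ring
    have hvk : v k = 0 := by
      by_contra hvk
      have hone : ((γ : ℂ) / μ) ^ L = 1 := by
        have := hiter L
        rw [hper] at this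
        exact mul_right_cancel₀ hvk (by rw [one_mul]; exact this.symm)
      have hnorm : R < ‖μ‖ := by
        have := Complex.norm_eq_one_of_pow_eq_one hone hL.ne'
        rw [norm_div, Complex.norm_real, Real.norm_of_nonneg hγ.le,
          div_eq_one_iff_eq (norm_ne_zero_iff.2 hμ)] at this
        exact this ▸ hγR
      refine hvk (hR μ hnorm (fun i => if i ∈ S then v i else 0) (v k) (fun i hi => if_neg hi)
        (fun r => ?_) (fun j => ?_))
      · rw [h.vecMul_congr (w := v) (fun j hj => if_pos hj)]
        by_cases hr : r ∈ S
        · rw [← hmulS v _ (hdS r hr), hA r, if_pos hr]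
        · rw [Pi.add_apply, h.vecMul_inl_eq_zero v hr, Pi.single_eq_of_ne (hcC r hr), if_neg hr]
          simp
      · rw [h.vecMul_congr (w := v) (fun j hj => if_pos hj), ← hmulS v, hB j]
        intro i hi
        rw [hσ i hi]
        exact Sum.inr_ne_inl
    have hvC : ∀ i ∈ C, v i = 0 := by
      intro i hi
      obtain ⟨l, rfl⟩ := (hC i).1 hi
      rw [hiter, hvk, mul_zero]
    have hsame : ∀ d, (v ᵥ* M'.map Complex.ofRealHom) d = (v ᵥ* M.map Complex.ofRealHom) d := by
      intro d
      rw [hmul, hvk, Finset.sum_eq_zero fun i _ => ?_]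
      · simp
      · split_ifs with hi
        · rw [hvC i hi.1, zero_mul]
        · rfl
    exact h.hautus μ hμ v (hsupp v hvC hv) (fun r => hsame _ ▸ hA r) (fun j => hsame _ ▸ hB j)

/-- As long as some state is missing, the partial realization can be enlarged. -/
theorem exists_ssubset [Fintype ι] (h : IsPartialRealization Abar Bbar φ S M)
    (hφ : Function.Injective φ) (hedge : ∀ k, inEdge Abar Bbar k (φ k) = true)
    (hin : ∀ C, IsNonTopLinked Abar C → ∃ r ∈ C, ∃ j, Bbar r j = true) (hS : S ≠ Finset.univ) :
    ∃ S' M', S ⊂ S' ∧ IsPartialRealization Abar Bbar φ S' M' := by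
  classical
  by_cases hstem : ∃ k ∉ S, ∀ r, φ k = Sum.inl r → r ∈ S
  · obtain ⟨k, hk, hc⟩ := hstem
    obtain ⟨M', hM'⟩ := h.exists_insert hφ hk (hedge k) hc
    exact ⟨_, M', Finset.ssubset_insert hk, hM'⟩
  -- otherwise the complement of `S` is a union of cycles of the matching
  push Not at hstem
  choose! σ hσ hσS using hstem
  obtain ⟨k, hk, c, hkc, hc⟩ : ∃ k ∉ S, ∃ c, inEdge Abar Bbar k c = true ∧
      ∀ r, c = Sum.inl r → r ∈ S := by
    by_contra! hno
    obtain ⟨x, hx⟩ : ∃ x, x ∉ S := by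
      by_contra! hall
      exact hS (Finset.eq_univ_iff_forall.2 hall)
    obtain ⟨C, hC, hCS⟩ := exists_isNonTopLinked_subset (Abar := Abar) (D := {k | k ∉ S}) ⟨x, hx⟩
      (fun j i hji hi => by
        obtain ⟨r, hr, hrS⟩ := hno i hi (Sum.inl j) hji
        exact Sum.inl.inj hr ▸ hrS)
    obtain ⟨r, hr, j, hj⟩ := hin C hC
    obtain ⟨r', hr', -⟩ := hno r (hCS hr) (Sum.inr j) hj
    exact absurd hr' Sum.inr_ne_inl
  let τ : {k // k ∉ S} → {k // k ∉ S} := fun k => ⟨σ k, hσS k k.2⟩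
  have hτ : Function.Injective τ := by
    intro a b hab
    have hab' : σ a = σ b := congrArg Subtype.val hab
    exact Subtype.ext (hφ (by rw [hσ a a.2, hσ b b.2, hab']))
  have hτσ : ∀ (l : ℕ) (a : {k // k ∉ S}), (τ^[l] a : Fin n) = σ^[l] a := by
    intro l a
    induction l with
    | zero => rfl
    | succ l ih => rw [Function.iterate_succ_apply', Function.iterate_succ_apply', ← ih]
  obtain ⟨L, hL, hper⟩ := hτ.mem_periodicPts ⟨k, hk⟩
  let C : Finset (Fin n) := {i | ∃ l : ℕ, σ^[l] k = i}
  have hC : ∀ i, i ∈ C ↔ ∃ l : ℕ, σ^[l] k = i := by simp [C]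
  have hCS : ∀ i ∈ C, i ∉ S := by
    intro i hi
    obtain ⟨l, rfl⟩ := (hC i).1 hi
    exact hτσ l ⟨k, hk⟩ ▸ (τ^[l] ⟨k, hk⟩).2
  obtain ⟨M', hM'⟩ := h.exists_union_cycle hφ hL hC
    ((hτσ L ⟨k, hk⟩).symm.trans (congrArg Subtype.val hper)) hCS (fun i hi => hσ i (hCS i hi))
    (fun i _ => hedge i) hc hkc
  refine ⟨S ∪ C, M', Finset.ssubset_iff_subset_ne.2 ⟨Finset.subset_union_left, fun heq => ?_⟩, hM'⟩
  exact hk (heq ▸ Finset.mem_union_right S ((hC k).2 ⟨0, rfl⟩))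

end IsPartialRealization

/-- **Lin's theorem**: a structured system is structurally controllable if and only if an input
acts on every non-top linked component, and the states can be matched injectively to in-neighbours
among the states and inputs. -/
theorem structurallyControllable_iff [Fintype ι] :
    StructurallyControllable Abar Bbar ↔
      (∀ C, IsNonTopLinked Abar C → ∃ r ∈ C, ∃ j, Bbar r j = true) ∧
      ∃ φ : Fin n → Fin n ⊕ ι, Function.Injective φ ∧ ∀ k, inEdge Abar Bbar k (φ k) = true := by
  classical
  refine ⟨fun h => ⟨fun C hC => h.exists_input hC, h.exists_matching⟩, ?_⟩
  rintro ⟨hin, φ, hφ, hedge⟩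
  obtain ⟨S, hS, hmax⟩ := Finset.exists_max_image
    {S : Finset (Fin n) | ∃ M, IsPartialRealization Abar Bbar φ S M} Finset.card
    ⟨∅, by simpa using ⟨0, IsPartialRealization.zero_empty⟩⟩
  simp only [Finset.mem_filter, Finset.mem_univ, true_and] at hS hmax
  obtain ⟨M, hM⟩ := hS
  have hSuniv : S = Finset.univ := by
    by_contra hne
    obtain ⟨S', M', hSS', hM'⟩ := hM.exists_ssubset hφ hedge hin hne
    exact absurd (hmax S' ⟨M', hM'⟩) (not_le.2 (Finset.card_lt_card hSS'))
  subst hSuniv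
  refine ⟨fun i r => M i (Sum.inl r), fun i j => M i (Sum.inr j),
    fun i r hir => hM.eq_zero i _ hir, fun i j hij => hM.eq_zero i _ hij,
    controllable_of_forall_left_eigenvector fun μ v hA hB => ?_⟩
  exact hM.eq_zero_of_left_eigenvector (fun k hk => absurd (Finset.mem_univ k) hk)
    (fun r => congrFun hA r) (fun j => congrFun hB j)

end Lin

noncomputable section

/-! ### Flows as functions on pairs of vertices -/

namespace FlowNetwork

variable {V : Type} (F : FlowNetwork V)

open Classical in
/-- A flow vector as a function on all pairs of vertices, zero off the edge set. -/
def extend (f : F.Edge → ℝ) (a b : V) : ℝ := if h : F.IsEdge a b then f ⟨(a, b), h⟩ else 0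

theorem extend_eq_zero (f : F.Edge → ℝ) {a b : V} (h : ¬F.IsEdge a b) : F.extend f a b = 0 :=
  dif_neg h

theorem extend_apply (f : F.Edge → ℝ) (e : F.Edge) : F.extend f e.1.1 e.1.2 = f e :=
  dif_pos e.2

variable [Fintype V] {G : V → V → ℝ}

theorem sum_edge (hG : ∀ a b, ¬F.IsEdge a b → G a b = 0) :
    ∑ e : F.Edge, G e.1.1 e.1.2 = ∑ a, ∑ b, G a b := by
  classical
  rw [← Fintype.sum_prod_type' G,
    ← Finset.sum_subtype {p : V × V | F.IsEdge p.1 p.2} (by simp) (fun p => G p.1 p.2),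
    Finset.sum_filter_of_ne]
  intro p _ hp
  by_contra h
  exact hp (hG _ _ h)

open Classical in
theorem sum_edge_snd_eq (hG : ∀ a b, ¬F.IsEdge a b → G a b = 0) (v : V) :
    ∑ e : F.Edge with e.1.2 = v, G e.1.1 e.1.2 = ∑ a, G a v := by
  rw [Finset.sum_filter, F.sum_edge (G := fun a b => if b = v then G a b else 0)
    (fun a b h => by simp [hG a b h])]
  simp

open Classical in
theorem sum_edge_fst_eq (hG : ∀ a b, ¬F.IsEdge a b → G a b = 0) (v : V) :
    ∑ e : F.Edge with e.1.1 = v, G e.1.1 e.1.2 = ∑ b, G v b := by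
  rw [Finset.sum_filter, F.sum_edge (G := fun a b => if a = v then G a b else 0)
    (fun a b h => by simp [hG a b h])]
  rw [Finset.sum_comm]
  simp

end FlowNetwork

/-! ### Flows on the network of a structured system -/

namespace Vertex

variable {N : Type} {n m : ℕ}

/-- The vertices as a disjoint union. -/
def equivSum : Vertex N n m ≃ Unit ⊕ Unit ⊕ N ⊕ Fin n ⊕ Fin n ⊕ Fin m ⊕ Fin m where
  toFun
    | .s => .inl ()
    | .t => .inr (.inl ())
    | .scc C => .inr (.inr (.inl C))
    | .x' k => .inr (.inr (.inr (.inl k)))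
    | .x r => .inr (.inr (.inr (.inr (.inl r))))
    | .u j => .inr (.inr (.inr (.inr (.inr (.inl j)))))
    | .u' j => .inr (.inr (.inr (.inr (.inr (.inr j)))))
  invFun
    | .inl _ => .s
    | .inr (.inl _) => .t
    | .inr (.inr (.inl C)) => .scc C
    | .inr (.inr (.inr (.inl k))) => .x' k
    | .inr (.inr (.inr (.inr (.inl r)))) => .x r
    | .inr (.inr (.inr (.inr (.inr (.inl j))))) => .u j
    | .inr (.inr (.inr (.inr (.inr (.inr j))))) => .u' j
  left_inv v := by cases v <;> rfl
  right_inv v := by rcases v with _ | _ | _ | _ | _ | _ | _ <;> rfl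

theorem sum_eq [Fintype N] [Fintype (Vertex N n m)] (g : Vertex N n m → ℝ) :
    ∑ v, g v = g .s + (g .t + (∑ C, g (.scc C) + (∑ k, g (.x' k) + (∑ r, g (.x r) +
      (∑ j, g (.u j) + ∑ j, g (.u' j)))))) := by
  rw [← Equiv.sum_comp equivSum.symm]
  simp [equivSum]

end Vertex

section Network

variable {n m : ℕ} {Abar : StructMatrix n (Fin n)} {Bbar : StructMatrix n (Fin m)}

/-- The function on pairs of vertices with the given values on the eight families of edges of the
flow network. -/
def ofParts {N : Type} (sc : N → ℝ) (sx : Fin n → ℝ) (cu : N → Fin m → ℝ) (xx : Fin n → Fin n → ℝ)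
    (xu : Fin n → Fin m → ℝ) (uu ut : Fin m → ℝ) (xt : Fin n → ℝ) :
    Vertex N n m → Vertex N n m → ℝ
  | .s, .scc C => sc C
  | .s, .x' k => sx k
  | .scc C, .u' j => cu C j
  | .x' k, .x r => xx k r
  | .x' k, .u j => xu k j
  | .u j, .u' j' => if j = j' then uu j else 0
  | .u' j, .t => ut j
  | .x r, .t => xt r
  | _, _ => 0

theorem eq_ofParts {G : Vertex (NonTopSCC Abar) n m → Vertex (NonTopSCC Abar) n m → ℝ}
    (hG : ∀ a b, ¬SystemEdge Abar Bbar a b → G a b = 0) :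
    G = ofParts (fun C => G .s (.scc C)) (fun k => G .s (.x' k)) (fun C j => G (.scc C) (.u' j))
      (fun k r => G (.x' k) (.x r)) (fun k j => G (.x' k) (.u j)) (fun j => G (.u j) (.u' j))
      (fun j => G (.u' j) .t) (fun r => G (.x r) .t) := by
  funext a b
  cases a <;> cases b <;> first | rfl | exact hG _ _ nofun | skip
  rename_i j j'
  by_cases hj : j = j'
  · subst hj; simp [ofParts]
  · simpa [ofParts, hj] using hG _ _ (by rintro ⟨⟩; exact hj rfl)

theorem flowCost_eq_inputCost (p : Fin m → ℝ) (f : (systemNetwork Abar Bbar p).Edge → ℝ) :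
    (systemNetwork Abar Bbar p).flowCost f = inputCost p (selectedInputs Abar Bbar p f) := by
  classical
  let := Fintype.ofFinite (NonTopSCC Abar)
  let := Fintype.ofFinite (Vertex (NonTopSCC Abar) n m)
  let F := systemNetwork Abar Bbar p
  have hsum := F.sum_edge (G := fun a b => if 0 < F.extend f a b then F.cost (a, b) else 0)
    (fun a b h => by simp [F.extend_eq_zero f h])
  simp only [F.extend_apply] at hsum
  rw [FlowNetwork.flowCost, Finset.sum_filter, inputCost, selectedInputs, Finset.sum_filter]
  refine (Finset.sum_congr rfl fun _ _ => by congr).trans (hsum.trans ?_)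
  simp only [F, systemNetwork, Vertex.sum_eq, systemCost, ite_self, Finset.sum_const_zero,
    add_zero, zero_add]
  refine Finset.sum_congr rfl fun j _ => ?_
  have := F.extend_apply f ⟨(.u' j, .t), SystemEdge.u'_t j⟩
  simp only [F, systemNetwork] at this
  exact if_congr (by rw [this]) rfl rfl

/-- A fractional matching that covers the rows yields an integral one on its support: a Hall
violator would carry more flow than its columns can take. -/
theorem exists_injective_of_fractional_matching {α β : Type} [Fintype α] [Fintype β]
    {g : α → β → ℝ} (h0 : ∀ a b, 0 ≤ g a b) (hrow : ∀ a, ∑ b, g a b = 1)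
    (hcol : ∀ b, ∑ a, g a b ≤ 1) :
    ∃ φ : α → β, Function.Injective φ ∧ ∀ a, 0 < g a (φ a) := by
  classical
  let t : α → Finset β := fun a => {b | 0 < g a b}
  have hall : ∀ X : Finset α, X.card ≤ (X.biUnion t).card := by
    intro X
    have h1 : (X.card : ℝ) ≤ (X.biUnion t).card := by
      calc (X.card : ℝ) = ∑ a ∈ X, ∑ b, g a b := by simp [hrow]
        _ = ∑ a ∈ X, ∑ b ∈ X.biUnion t, g a b := by
            refine Finset.sum_congr rfl fun a ha => ?_
            refine (Finset.sum_subset (Finset.subset_univ _) fun b _ hb => ?_).symm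
            by_contra hne
            exact hb (Finset.mem_biUnion.2 ⟨a, ha, by
              simpa [t] using lt_of_le_of_ne (h0 a b) (Ne.symm hne)⟩)
        _ = ∑ b ∈ X.biUnion t, ∑ a ∈ X, g a b := Finset.sum_comm
        _ ≤ ∑ b ∈ X.biUnion t, 1 := by
            refine Finset.sum_le_sum fun b _ => le_trans ?_ (hcol b)
            exact Finset.sum_le_sum_of_subset_of_nonneg (Finset.subset_univ _)
              fun a _ _ => h0 a b
        _ = _ := by simp
    exact_mod_cast h1
  obtain ⟨φ, hφ, hφt⟩ := (Finset.all_card_le_biUnion_card_iff_exists_injective t).1 hall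
  exact ⟨φ, hφ, fun k => by simpa [t] using hφt k⟩

/-- Lin's theorem for the system driven by the inputs in `W`. -/
theorem mem_admissibleInputs_iff {W : Finset (Fin m)} :
    W ∈ admissibleInputs Abar Bbar ↔
      (∀ C : NonTopSCC Abar, ∃ r ∈ C.1, ∃ j ∈ W, Bbar r j = true) ∧
      ∃ φ : Fin n → Fin n ⊕ Fin m, Function.Injective φ ∧
        (∀ k, inEdge Abar Bbar k (φ k) = true) ∧ ∀ k j, φ k = Sum.inr j → j ∈ W := by
  refine structurallyControllable_iff.trans (and_congr ⟨fun h C => ?_, fun h C hC => ?_⟩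
    ⟨?_, ?_⟩)
  · obtain ⟨r, hr, j, hj⟩ := h C.1 C.2
    exact ⟨r, hr, j, j.2, hj⟩
  · obtain ⟨r, hr, j, hjW, hj⟩ := h ⟨C, hC⟩
    exact ⟨r, hr, ⟨j, hjW⟩, hj⟩
  · rintro ⟨φ, hφ, hedge⟩
    refine ⟨fun k => Sum.map id Subtype.val (φ k),
      (Sum.map_injective.2 ⟨Function.injective_id, Subtype.val_injective⟩).comp hφ,
      fun k => ?_, fun k j hkj => ?_⟩
    · have := hedge k
      rcases h : φ k with r | j <;> rw [h] at this <;> simp only [h] <;> exact this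
    · rcases h : φ k with r | j' <;> simp only [h, Sum.map_inl, Sum.map_inr] at hkj
      · exact absurd hkj Sum.inl_ne_inr
      · exact Sum.inr.inj hkj ▸ j'.2
  · rintro ⟨φ, hφ, hedge, hW⟩
    have hlift : ∀ k, ∃ c : Fin n ⊕ W, Sum.map id Subtype.val c = φ k := by
      intro k
      rcases h : φ k with r | j
      · exact ⟨Sum.inl r, rfl⟩
      · exact ⟨Sum.inr ⟨j, hW k j h⟩, rfl⟩
    choose ψ hψ using hlift
    refine ⟨ψ, fun a b hab => hφ (by rw [← hψ, ← hψ, hab]), fun k => ?_⟩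
    have := hedge k
    rw [← hψ k] at this
    rcases h : ψ k with r | j <;> rw [h] at this <;> exact this

/-- A feasible solution saturates all edges leaving the source, so that it exhibits the two
conditions of Lin's theorem on its support. -/
theorem selectedInputs_mem_admissibleInputs {p : Fin m → ℝ}
    {f : (systemNetwork Abar Bbar p).Edge → ℝ}
    (hf : (systemNetwork Abar Bbar p).IsMCFFFeasible ((numNonTopSCC Abar : ℝ) + n) f) :
    selectedInputs Abar Bbar p f ∈ admissibleInputs Abar Bbar := by
  classical
  let := Fintype.ofFinite (NonTopSCC Abar)
  let := Fintype.ofFinite (Vertex (NonTopSCC Abar) n m)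
  let F := systemNetwork Abar Bbar p
  let G := F.extend f
  have hG : ∀ a b, ¬SystemEdge Abar Bbar a b → G a b = 0 := fun a b h => F.extend_eq_zero f h
  obtain ⟨⟨hnonneg, hcap, hcons⟩, hval⟩ := hf
  have hfG : f = fun e => G e.1.1 e.1.2 := funext fun e => (F.extend_apply f e).symm
  have hG0 : ∀ a b, 0 ≤ G a b := by
    intro a b
    simp only [G, FlowNetwork.extend]
    split_ifs
    exacts [hnonneg _, le_rfl]
  have hGcap : ∀ a b, SystemEdge Abar Bbar a b → G a b ≤ systemCap (a, b) := by
    intro a b h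
    exact (F.extend_apply f ⟨(a, b), h⟩).trans_le (hcap ⟨(a, b), h⟩)
  have hGcons : ∀ v, v ≠ .s → v ≠ .t → ∑ a, G a v = ∑ b, G v b := by
    intro v hs ht
    rw [← F.sum_edge_snd_eq hG, ← F.sum_edge_fst_eq hG]
    convert hcons v hs ht using 2 <;> rw [hfG]
  have hGval : (numNonTopSCC Abar : ℝ) + n ≤ ∑ b, G .s b := by
    rw [← F.sum_edge_fst_eq hG]
    convert hval using 1
    rw [FlowNetwork.flowValue, hfG]
    rfl
  have hP := eq_ofParts hG
  have hW : ∀ j, j ∈ selectedInputs Abar Bbar p f ↔ 0 < G (.u' j) .t := by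
    intro j
    rw [selectedInputs, Finset.mem_filter, ← F.extend_apply f ⟨(.u' j, .t), SystemEdge.u'_t j⟩]
    simp [G, F]
  have hscc : ∀ C, G .s (.scc C) = ∑ j, G (.scc C) (.u' j) := by
    intro C
    have := hGcons (.scc C) nofun nofun
    rw [hP] at this
    simpa [Vertex.sum_eq, ofParts] using this
  have hx' : ∀ k, G .s (.x' k) = ∑ r, G (.x' k) (.x r) + ∑ j, G (.x' k) (.u j) := by
    intro k
    have := hGcons (.x' k) nofun nofun
    rw [hP] at this
    simpa [Vertex.sum_eq, ofParts] using this
  have hx : ∀ r, ∑ k, G (.x' k) (.x r) = G (.x r) .t := by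
    intro r
    have := hGcons (.x r) nofun nofun
    rw [hP] at this
    simpa [Vertex.sum_eq, ofParts] using this
  have hu : ∀ j, ∑ k, G (.x' k) (.u j) = G (.u j) (.u' j) := by
    intro j
    have := hGcons (.u j) nofun nofun
    rw [hP] at this
    simpa [Vertex.sum_eq, ofParts] using this
  have hu' : ∀ j, ∑ C, G (.scc C) (.u' j) + G (.u j) (.u' j) = G (.u' j) .t := by
    intro j
    have := hGcons (.u' j) nofun nofun
    rw [hP] at this
    simpa [Vertex.sum_eq, ofParts] using this
  -- the edges that leave the source are saturated
  have hsat : ∀ w : NonTopSCC Abar ⊕ Fin n, Sum.elim (fun C => G .s (.scc C))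
      (fun k => G .s (.x' k)) w = 1 := by
    have hle : ∀ w ∈ (Finset.univ : Finset (NonTopSCC Abar ⊕ Fin n)),
        Sum.elim (fun C => G .s (.scc C)) (fun k => G .s (.x' k)) w ≤ 1 := by
      rintro (C | k) -
      · exact hGcap _ _ (.s_scc C)
      · exact hGcap _ _ (.s_x' k)
    have heq := (Finset.sum_eq_sum_iff_of_le hle).1 (le_antisymm (Finset.sum_le_sum hle) (by
      rw [hP] at hGval
      simpa [Vertex.sum_eq, ofParts, numNonTopSCC, Nat.card_eq_fintype_card] using hGval))
    exact fun w => heq w (Finset.mem_univ w)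
  rw [mem_admissibleInputs_iff]
  constructor
  · intro C
    have h1 : 0 < ∑ j, G (.scc C) (.u' j) := by
      rw [← hscc]
      exact one_pos.trans_eq (hsat (.inl C)).symm
    obtain ⟨j, -, hj⟩ := (Finset.sum_pos_iff_of_nonneg fun j _ => hG0 _ _).1 h1
    have hedge : SystemEdge Abar Bbar (.scc C) (.u' j) := by
      by_contra h
      exact hj.ne' (hG _ _ h)
    cases hedge with
    | scc_u' _ r _ hr hB =>
      refine ⟨r, hr, j, (hW j).2 ?_, hB⟩
      rw [← hu' j]
      exact add_pos_of_pos_of_nonneg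
        (Finset.sum_pos_iff_of_nonneg (fun C _ => hG0 _ _) |>.2 ⟨C, Finset.mem_univ C, hj⟩)
        (hG0 _ _)
  · obtain ⟨φ, hφ, hpos⟩ := exists_injective_of_fractional_matching
      (g := fun k => Sum.elim (fun r => G (.x' k) (.x r)) (fun j => G (.x' k) (.u j)))
      (by rintro k (r | j) <;> exact hG0 _ _)
      (fun k => by
        rw [Fintype.sum_sum_type]
        exact (hx' k).symm.trans (hsat (.inr k)))
      (by
        rintro (r | j)
        · exact (hx r).trans_le (hGcap _ _ (.x_t r))
        · exact (hu j).trans_le (hGcap _ _ (.u_u' j)))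
    refine ⟨φ, hφ, fun k => ?_, fun k j hkj => ?_⟩
    · have hk := hpos k
      rcases hφk : φ k with r | j <;> rw [hφk] at hk
      · have hedge : SystemEdge Abar Bbar (.x' k) (.x r) := by
          by_contra h
          exact hk.ne' (hG _ _ h)
        cases hedge with
        | x'_x _ _ hA => exact hA
      · have hedge : SystemEdge Abar Bbar (.x' k) (.u j) := by
          by_contra h
          exact hk.ne' (hG _ _ h)
        cases hedge with
        | x'_u _ _ hB => exact hB
    · have hk := hpos k
      rw [hkj] at hk
      rw [hW, ← hu' j, ← hu j]
      exact add_pos_of_nonneg_of_pos (Finset.sum_nonneg fun C _ => hG0 _ _)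
        ((Finset.sum_pos_iff_of_nonneg fun k _ => hG0 _ _).2 ⟨k, Finset.mem_univ k, hk⟩)

theorem numNonTopSCC_le : numNonTopSCC Abar ≤ n := by
  -- the components are disjoint and non-empty
  choose r hr using fun C : NonTopSCC Abar => C.2.nonempty
  have hinj : Function.Injective r := fun C D h =>
    Subtype.ext (C.2.eq_of_mem D.2 (hr C) (h ▸ hr D))
  simpa [numNonTopSCC] using Nat.card_le_card_of_injective r hinj

/-- An admissible input set carries a flow: every non-top linked component sends its unit to one
of its inputs, and every state sends its unit along a matching. -/
theorem exists_isMCFFFeasible_of_mem_admissibleInputs (p : Fin m → ℝ) {W : Finset (Fin m)}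
    (hW : W ∈ admissibleInputs Abar Bbar) :
    ∃ g, (systemNetwork Abar Bbar p).IsMCFFFeasible ((numNonTopSCC Abar : ℝ) + n) g ∧
      selectedInputs Abar Bbar p g ⊆ W := by
  classical
  let := Fintype.ofFinite (NonTopSCC Abar)
  let := Fintype.ofFinite (Vertex (NonTopSCC Abar) n m)
  let F := systemNetwork Abar Bbar p
  obtain ⟨hin, φ, hφ, hedge, hφW⟩ := mem_admissibleInputs_iff.1 hW
  choose r hr j hjW hB using hin
  -- the amount of the matching that arrives at a state or an input
  let d : Fin n ⊕ Fin m → ℝ := fun c => ∑ k, if φ k = c then 1 else 0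
  have hd0 : ∀ c, 0 ≤ d c := fun c => Finset.sum_nonneg fun k _ => by split_ifs <;> simp
  have hd1 : ∀ c, d c ≤ 1 := by
    intro c
    simp only [d, Finset.sum_boole]
    refine Nat.cast_le_one.2 (Finset.card_le_one.2 fun a ha b hb => hφ ?_)
    exact (Finset.mem_filter.1 ha).2.trans (Finset.mem_filter.1 hb).2.symm
  let G : Vertex (NonTopSCC Abar) n m → Vertex (NonTopSCC Abar) n m → ℝ :=
    ofParts (fun _ => 1) (fun _ => 1) (fun C i => if j C = i then 1 else 0)
      (fun k r => if φ k = .inl r then 1 else 0) (fun k i => if φ k = .inr i then 1 else 0)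
      (fun i => d (.inr i)) (fun i => (∑ C, if j C = i then 1 else 0) + d (.inr i))
      (fun r => d (.inl r))
  have hG : ∀ a b, ¬SystemEdge Abar Bbar a b → G a b = 0 := by
    intro a b h
    by_contra hne
    apply h
    cases a <;> cases b <;> first | exact absurd rfl hne | skip
    · exact .s_scc _
    · exact .s_x' _
    · rename_i C i
      simp only [G, ofParts, ite_eq_right_iff, one_ne_zero, imp_false, not_not] at hne
      exact hne ▸ .scc_u' C (r C) (j C) (hr C) (hB C)
    · rename_i k r
      simp only [G, ofParts, ite_eq_right_iff, one_ne_zero, imp_false, not_not] at hne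
      have := hedge k
      rw [hne] at this
      exact .x'_x k r this
    · rename_i k i
      simp only [G, ofParts, ite_eq_right_iff, one_ne_zero, imp_false, not_not] at hne
      have := hedge k
      rw [hne] at this
      exact .x'_u k i this
    · exact .x_t _
    · rename_i i i'
      have : i = i' := by
        by_contra hii
        exact hne (by simp [G, ofParts, hii])
      exact this ▸ .u_u' i
    · exact .u'_t _
  have hG0 : ∀ a b, 0 ≤ G a b := by
    intro a b
    cases a <;> cases b <;> simp only [G, ofParts] <;> positivity
  have hcap : ∀ a b, SystemEdge Abar Bbar a b → G a b ≤ systemCap (a, b) := by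
    intro a b h
    cases h <;> simp only [G, ofParts, systemCap, le_refl, if_true, hd1]
    · split_ifs <;> simp
    · split_ifs <;> simp
    · split_ifs <;> simp
    · refine add_le_add ?_ (hd1 _)
      calc (∑ C, if j C = _ then (1 : ℝ) else 0) ≤ ∑ C : NonTopSCC Abar, 1 :=
            Finset.sum_le_sum fun C _ => by split_ifs <;> simp
        _ = numNonTopSCC Abar := by simp [numNonTopSCC, Nat.card_eq_fintype_card]
        _ ≤ n := by exact_mod_cast numNonTopSCC_le
  have hk : ∀ k, (∑ r, if φ k = .inl r then (1 : ℝ) else 0) +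
      ∑ i, (if φ k = .inr i then (1 : ℝ) else 0) = 1 := by
    intro k
    rcases φ k with r | i <;> simp
  refine ⟨fun e => G e.1.1 e.1.2,
    ⟨⟨fun e => hG0 _ _, fun e => hcap _ _ e.2, fun v hs ht => ?_⟩, ?_⟩, fun i hi => ?_⟩
  · refine (F.sum_edge_snd_eq hG v).trans (Eq.trans ?_ (F.sum_edge_fst_eq hG v).symm)
    cases v with
    | s => exact absurd rfl hs
    | t => exact absurd rfl ht
    | scc C => simp [Vertex.sum_eq, G, ofParts]
    | x' k => simpa [Vertex.sum_eq, G, ofParts] using (hk k).symm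
    | x r => simp [Vertex.sum_eq, G, ofParts, d]
    | u i => simp [Vertex.sum_eq, G, ofParts, d]
    | u' i => simp [Vertex.sum_eq, G, ofParts]
  · refine le_of_le_of_eq ?_ (F.sum_edge_fst_eq hG .s).symm
    simp [Vertex.sum_eq, G, ofParts, numNonTopSCC, Nat.card_eq_fintype_card]
  · have hpos : 0 < (∑ C, if j C = i then (1 : ℝ) else 0) + d (.inr i) :=
      (Finset.mem_filter.1 hi).2
    by_contra hiW
    have h1 : ∀ C, j C ≠ i := fun C h => hiW (h ▸ hjW C)
    have h2 : ∀ k, φ k ≠ .inr i := fun k h => hiW (hφW k i h)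
    simp [h1, h2, d] at hpos

end Network

end

end StructSys

theorem mainTheorem4 {n m : ℕ}
    (Abar : StructSys.StructMatrix n (Fin n)) (Bbar : StructSys.StructMatrix n (Fin m))
    (p : Fin m → ℝ) (hp : ∀ j, 0 ≤ p j)
    (hctrl : StructSys.StructurallyControllable Abar Bbar)
    (f : (StructSys.systemNetwork Abar Bbar p).Edge → ℝ)
    (hf : (StructSys.systemNetwork Abar Bbar p).IsMCFFFeasible
      ((StructSys.numNonTopSCC Abar : ℝ) + n) f)
    (ε : ℝ) (hε : 1 ≤ ε)
    (hcost : (StructSys.systemNetwork Abar Bbar p).flowCost f ≤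
      ε * (StructSys.systemNetwork Abar Bbar p).mcffOptimalCost
        ((StructSys.numNonTopSCC Abar : ℝ) + n)) :
    StructSys.selectedInputs Abar Bbar p f ∈ StructSys.admissibleInputs Abar Bbar ∧
      StructSys.inputCost p (StructSys.selectedInputs Abar Bbar p f) ≤
        ε * StructSys.minInputCost Abar Bbar p := by
  refine ⟨StructSys.selectedInputs_mem_admissibleInputs hf, ?_⟩
  obtain ⟨⟨W, hW, hWp⟩, -⟩ := StructSys.isLeast_minInputCost p hctrl
  obtain ⟨g, hg, hgW⟩ := StructSys.exists_isMCFFFeasible_of_mem_admissibleInputs p hW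
  have hopt := ((StructSys.systemNetwork Abar Bbar p).isLeast_mcffOptimalCost hf).2 ⟨g, hg, rfl⟩
  rw [StructSys.flowCost_eq_inputCost] at hcost hopt
  have hsub : StructSys.inputCost p (StructSys.selectedInputs Abar Bbar p g) ≤
      StructSys.inputCost p W :=
    Finset.sum_le_sum_of_subset_of_nonneg hgW fun j _ _ => hp j
  rw [← hWp]
  exact hcost.trans (mul_le_mul_of_nonneg_left (hopt.trans hsub) (zero_le_one.trans hε))
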